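/- Let $v_1,\dots,v_n$ ($n\ge 1$) be distinct points of a metric space with distance $|\cdot|$, and let $P$ be the path graph $v_1v_2\cdots v_n$ whose edge $e(v_k,v_{k+1})$ has length $|v_kv_{k+1}|$. For a pair of indices $(i,j)$ let $G(i,j)=P\cup\{e(v_i,v_j)\}$ be the graph obtained by adding the edge $e(v_i,v_j)$ of length $|v_iv_j|$ (so $G(i,j)=P$ if $|i-j|\le 1$). A point of $G(i,j)$ is a vertex or a point in the interior of an edge. A center of $G(i,j)$ is a point that minimizes the largest shortest-path distance in $G(i,j)$ from it to the vertices, and the radius of $G(i,j)$ is this largest distance for a center. Assume that $|v_kv_l|$ can be obtained in $O(1)$ time for any two indices $k,l$. Then, after $O(n)$ time preprocessing of the path, for any query pair of indices $(i,j)$ the radius and a center of $G(i,j)$ can be computed in $O(\log n)$ time. Precisely: on a real RAM (integers of size $O(n)$ with addition, truncated subtraction and halving; exact reals with addition, subtraction and halving; comparisons; indirect addressing; an instruction that returns $|v_kv_l|$ for given $k,l$; every instruction and every comparison costs one step), there are a preprocessing program, a query program and a constant $C$, all independent of $n$ and of the metric space, such that preprocessing takes at most $C\,n$ steps and afterwards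 each query, in any sequence of queries, takes at most $C\,(1+\lfloor\log_2 n\rfloor)$ steps and outputs the radius and a center of $G(i,j)$ (the center as an edge, or a vertex, together with the distance along that edge from its first end). -/

import Mathlib

/-! ## The augmented path, its points, centers and radius -/

namespace AugPath

/-- The graph obtained from the path `0 - 1 - ⋯ - (n-1)` by adding the edge between `i` and `j`
(nothing is added if `i = j` or if the edge is already present). -/
def graph {n : ℕ} (i j : Fin n) : SimpleGraph (Fin n) :=
  SimpleGraph.pathGraph n ⊔ SimpleGraph.edge i j

variable {n : ℕ} (G : SimpleGraph (Fin n)) (d : Fin n → Fin n → ℝ)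

/-- The length of a walk, an edge between `a` and `b` having length `d a b`. -/
noncomputable def walkLength {G : SimpleGraph (Fin n)} {a b : Fin n} (w : G.Walk a b) : ℝ :=
  (w.darts.map fun e => d e.fst e.snd).sum

/-- Shortest path length between two vertices of `G`. -/
noncomputable def graphDist (a b : Fin n) : ℝ :=
  ⨅ w : G.Walk a b, walkLength d w

/-- A point of the metric graph `G`: either a vertex (`a = b`, and then `t = 0` when `d a a = 0`),
or the point of the edge `ab` that lies at distance `t` from `a` along this edge. -/
structure Point where
  a : Fin n
  b : Fin n
  t : ℝ
  on_graph : a = b ∨ G.Adj a b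
  nonneg : 0 ≤ t
  le_length : t ≤ d a b

/-- Shortest path length in `G` from a point to a vertex: a path leaves the edge on which the
point lies through one of its two ends. -/
noncomputable def pointDist {G : SimpleGraph (Fin n)} {d : Fin n → Fin n → ℝ} (p : Point G d)
    (x : Fin n) : ℝ :=
  min (p.t + graphDist G d p.a x) (d p.a p.b - p.t + graphDist G d p.b x)

/-- The largest distance in `G` from a point to the vertices. -/
noncomputable def ecc {G : SimpleGraph (Fin n)} {d : Fin n → Fin n → ℝ} (p : Point G d) : ℝ :=
  ⨆ x : Fin n, pointDist p x

/-- A center: a point (vertex or interior point of an edge) that minimizes the largest distance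
to the vertices. -/
def IsCenter {G : SimpleGraph (Fin n)} {d : Fin n → Fin n → ℝ} (p : Point G d) : Prop :=
  ∀ q : Point G d, ecc p ≤ ecc q

/-- `r` is the radius: the largest distance from a center to the vertices. -/
def IsRadius (r : ℝ) : Prop :=
  ∃ p : Point G d, IsCenter p ∧ ecc p = r

end AugPath

/-! ## A real RAM with a distance oracle

Integers are machine words (at most a given bound `M`); reals are exact and can only be added,
subtracted, halved, compared and moved (no rounding, no conversion to integers). A program text is
finite, so that it names finitely many registers and finitely many arrays. -/

namespace RealRAM

/-- Integer registers, real registers, integer arrays, real arrays. Arrays are named by the first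
argument and accessed by an index held in an integer register. -/
structure State where
  ireg : ℕ → ℕ
  rreg : ℕ → ℝ
  iarr : ℕ → ℕ → ℕ
  rarr : ℕ → ℕ → ℝ

inductive Instr
  /-- `I[x] := c` -/
  | iconst (x c : ℕ)
  /-- `I[x] := I[y] + I[z]` -/
  | iadd (x y z : ℕ)
  /-- `I[x] := max (I[y] - I[z]) 0` -/
  | isub (x y z : ℕ)
  /-- `I[x] := ⌊I[y] / 2⌋` -/
  | ihalf (x y : ℕ)
  /-- `I[x] := A[I[y]]`, with `A` an integer array -/
  | iload (x A y : ℕ)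
  /-- `A[I[y]] := I[x]`, with `A` an integer array -/
  | istore (A y x : ℕ)
  /-- `R[x] := R[y] + R[z]` -/
  | radd (x y z : ℕ)
  /-- `R[x] := R[y] - R[z]` -/
  | rsub (x y z : ℕ)
  /-- `R[x] := R[y] / 2` -/
  | rhalf (x y : ℕ)
  /-- `R[x] := A[I[y]]`, with `A` a real array -/
  | rload (x A y : ℕ)
  /-- `A[I[y]] := R[x]`, with `A` a real array -/
  | rstore (A y x : ℕ)
  /-- `R[x] :=` the distance between the vertices with indices `I[y]` and `I[z]` -/
  | dist (x y z : ℕ)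

inductive Test
  /-- `I[x] ≤ I[y]` -/
  | ile (x y : ℕ)
  /-- `R[x] ≤ R[y]` -/
  | rle (x y : ℕ)

inductive Prog
  | skip
  | op (c : Instr)
  | seq (p q : Prog)
  | branch (b : Test) (p q : Prog)
  | loop (b : Test) (p : Prog)

/-- Write an integer register; this fails if the value does not fit in a word. -/
def State.setI (M : ℕ) (s : State) (x k : ℕ) : Option State :=
  if k ≤ M then some { s with ireg := Function.update s.ireg x k } else none

/-- Write a real register. -/
def State.setR (s : State) (x : ℕ) (r : ℝ) : State :=
  { s with rreg := Function.update s.rreg x r }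

/-- One instruction, for the distance oracle `d` and the word bound `M`; `none` means failure. -/
noncomputable def Instr.step {n : ℕ} (d : Fin n → Fin n → ℝ) (M : ℕ) :
    Instr → State → Option State
  | .iconst x c, s => s.setI M x c
  | .iadd x y z, s => s.setI M x (s.ireg y + s.ireg z)
  | .isub x y z, s => s.setI M x (s.ireg y - s.ireg z)
  | .ihalf x y, s => s.setI M x (s.ireg y / 2)
  | .iload x A y, s => s.setI M x (s.iarr A (s.ireg y))
  | .istore A y x, s =>
      some { s with iarr := Function.update s.iarr A
                              (Function.update (s.iarr A) (s.ireg y) (s.ireg x)) }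
  | .radd x y z, s => some (s.setR x (s.rreg y + s.rreg z))
  | .rsub x y z, s => some (s.setR x (s.rreg y - s.rreg z))
  | .rhalf x y, s => some (s.setR x (s.rreg y / 2))
  | .rload x A y, s => some (s.setR x (s.rarr A (s.ireg y)))
  | .rstore A y x, s =>
      some { s with rarr := Function.update s.rarr A
                              (Function.update (s.rarr A) (s.ireg y) (s.rreg x)) }
  | .dist x y z, s =>
      if h : s.ireg y < n ∧ s.ireg z < n then
        some (s.setR x (d ⟨s.ireg y, h.1⟩ ⟨s.ireg z, h.2⟩))
      else none

def Test.holds : Test → State → Prop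
  | .ile x y, s => s.ireg x ≤ s.ireg y
  | .rle x y, s => s.rreg x ≤ s.rreg y

/-- `Exec d M p s s' t`: started in the state `s`, the program `p` halts without failure in the
state `s'` after exactly `t` steps; every instruction and every evaluation of a test is a step. -/
inductive Exec {n : ℕ} (d : Fin n → Fin n → ℝ) (M : ℕ) : Prog → State → State → ℕ → Prop
  | skip (s : State) : Exec d M .skip s s 1
  | op {c : Instr} {s s' : State} : c.step d M s = some s' → Exec d M (.op c) s s' 1
  | seq {p q : Prog} {s₁ s₂ s₃ : State} {t u : ℕ} :
      Exec d M p s₁ s₂ t → Exec d M q s₂ s₃ u → Exec d M (.seq p q) s₁ s₃ (t + u)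
  | branch_true {b : Test} {p q : Prog} {s s' : State} {t : ℕ} :
      b.holds s → Exec d M p s s' t → Exec d M (.branch b p q) s s' (t + 1)
  | branch_false {b : Test} {p q : Prog} {s s' : State} {t : ℕ} :
      ¬ b.holds s → Exec d M q s s' t → Exec d M (.branch b p q) s s' (t + 1)
  | loop_true {b : Test} {p : Prog} {s₁ s₂ s₃ : State} {t u : ℕ} :
      b.holds s₁ → Exec d M p s₁ s₂ t → Exec d M (.loop b p) s₂ s₃ u →
        Exec d M (.loop b p) s₁ s₃ (t + u + 1)
  | loop_false {b : Test} {p : Prog} {s : State} :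
      ¬ b.holds s → Exec d M (.loop b p) s s 1

/-- The machine is deterministic: the result and the number of steps of a run are unique. -/
theorem Exec.deterministic {n : ℕ} {d : Fin n → Fin n → ℝ} {M : ℕ} {p : Prog} {s s₁ s₂ : State}
    {t₁ t₂ : ℕ} (h₁ : Exec d M p s s₁ t₁) (h₂ : Exec d M p s s₂ t₂) : s₁ = s₂ ∧ t₁ = t₂ := by
  induction h₁ generalizing s₂ t₂ with
  | skip s => cases h₂; exact ⟨rfl, rfl⟩
  | op h => cases h₂ with
    | op h' => exact ⟨Option.some.inj (h.symm.trans h'), rfl⟩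
  | seq _ _ ih₁ ih₂ => cases h₂ with
    | seq k₁ k₂ =>
      obtain ⟨rfl, rfl⟩ := ih₁ k₁
      obtain ⟨rfl, rfl⟩ := ih₂ k₂
      exact ⟨rfl, rfl⟩
  | branch_true hb _ ih => cases h₂ with
    | branch_true _ k => obtain ⟨rfl, rfl⟩ := ih k; exact ⟨rfl, rfl⟩
    | branch_false hb' _ => exact absurd hb hb'
  | branch_false hb _ ih => cases h₂ with
    | branch_true hb' _ => exact absurd hb' hb
    | branch_false _ k => obtain ⟨rfl, rfl⟩ := ih k; exact ⟨rfl, rfl⟩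
  | loop_true hb _ _ ih₁ ih₂ => cases h₂ with
    | loop_true _ k₁ k₂ =>
      obtain ⟨rfl, rfl⟩ := ih₁ k₁
      obtain ⟨rfl, rfl⟩ := ih₂ k₂
      exact ⟨rfl, rfl⟩
    | loop_false hb' => exact absurd hb hb'
  | loop_false hb => cases h₂ with
    | loop_true hb' _ _ => exact absurd hb' hb
    | loop_false _ => exact ⟨rfl, rfl⟩

/-- The state before preprocessing: `I[0] = n`, everything else is zero. -/
def State.start (n : ℕ) : State where
  ireg := Function.update (fun _ => 0) 0 n
  rreg := fun _ => 0
  iarr := fun _ _ => 0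
  rarr := fun _ _ => 0

/-- Hand the query `(i, j)` to the machine: `I[0] := i`, `I[1] := j`. -/
def State.query {n : ℕ} (s : State) (i j : Fin n) : State :=
  { s with ireg := Function.update (Function.update s.ireg 0 i) 1 j }

/-- The states in which the machine waits for a query: the one left by the preprocessing program
`pre`, and those left by the query program `qry` after any sequence of queries. -/
inductive Waiting {n : ℕ} (d : Fin n → Fin n → ℝ) (M : ℕ) (pre qry : Prog) : State → Prop
  | preprocessed {s : State} {t : ℕ} :
      Exec d M pre (State.start n) s t → Waiting d M pre qry s
  | answered {s s' : State} {t : ℕ} (i j : Fin n) :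
      Waiting d M pre qry s → Exec d M qry (s.query i j) s' t → Waiting d M pre qry s'

/-- The answer that the machine shows in the state `s` consists of the point of `G` on the edge
`I[0] I[1]` (or the vertex `I[0] = I[1]`) at distance `R[0]` from `I[0]`, and of the real `R[1]`. -/
def State.Shows {n : ℕ} {G : SimpleGraph (Fin n)} {d : Fin n → Fin n → ℝ} (s : State)
    (c : AugPath.Point G d) (r : ℝ) : Prop :=
  s.ireg 0 = c.a ∧ s.ireg 1 = c.b ∧ s.rreg 0 = c.t ∧ s.rreg 1 = r

end RealRAM

/-! ## Reasoning about runs of the machine -/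

/-! Place the vertices on a line at their positions `x k` along the path, indices starting at 0. By
the triangle inequality the shortcut between `i ≤ j` has length `e ≤ x j - x i`. So the graph is a
cycle of length `L = x j - x i + e` with a tail of length `a = x i` at `i` and a tail of length `b =
x (n - 1) - x j` at `j`. Using the shortcut more than once never helps, so graph distances have the
closed form `lineDist` (`IsDist.graphDist_eq`).

Let `R` be the largest distance from `i` to the vertices that do not precede it. If `R ≤ a`, a
center lies on the left tail, halfway between vertex 0 and a vertex that realizes `R`, and the
radius is `(a + R) / 2` (`isLowerBound_of_reachRight_le`). The right tail is symmetric. If neither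
happens, no tail point beats the cycle (`isLowerBound_of_far`).

On the cycle, a vertex is at distance at least `L / 2 - ρ` from a point exactly if it is within `ρ`
of the antipode of that point. The end of a tail behaves like the foot of the tail, with `ρ`
enlarged by the length of the tail. So delete from the cycle its vertices, the arc of radius `a`
around `i` and the arc of radius `b` around `j`. If the longest interval that remains has length
`w`, the antipode of its midpoint is optimal and the radius is `(L - w) / 2` (`far_of_gaps`,
`near_of_gap`, `near_of_shortcut_gap`). If `x j - x i ≤ a + b`, nothing remains, and the midpoint of
a shortest path between the two tail ends is optimal, with radius `(a + b + e) / 2` (`far_of_cover`,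
`near_of_cover`).

For the running time: the distance from `i` to the vertices of the cycle first grows and then
shrinks along the path, so binary search finds `R`. The longest interval on the path is one of the
two pieces at the ends of a range or a path edge inside it, hence a range maximum, read off a
bottom-up tree over the edges. The shortcut contributes the single candidate `e - a - b`.

Degenerate queries need no separate treatment: if `ij` is a path edge, the cycle is this edge taken
twice; if `i = j`, then `R = b` and its mirror image is `a`, so one of the tail cases applies. -/

namespace RealRAM

variable {n : ℕ} {d : Fin n → Fin n → ℝ} {M : ℕ}

/-- Started in the state `s`, the program `p` halts within `T` steps in a state that satisfies `Q`. -/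
def Run (d : Fin n → Fin n → ℝ) (M : ℕ) (p : Prog) (s : State) (T : ℕ) (Q : State → Prop) : Prop :=
  ∃ s' t, Exec d M p s s' t ∧ t ≤ T ∧ Q s'

/-- Write an integer register, ignoring the word bound. -/
def State.putI (s : State) (x k : ℕ) : State :=
  { s with ireg := Function.update s.ireg x k }

/-- Write an element of a real array. -/
def State.putA (s : State) (A k : ℕ) (r : ℝ) : State :=
  { s with rarr := Function.update s.rarr A (Function.update (s.rarr A) k r) }

section Projections

variable (s : State) (x k y : ℕ) (r : ℝ)

@[simp] theorem State.setR_rreg : (s.setR x r).rreg y = if y = x then r else s.rreg y := by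
  simp [State.setR, Function.update_apply]
@[simp] theorem State.setR_ireg : (s.setR x r).ireg = s.ireg := rfl
@[simp] theorem State.setR_rarr : (s.setR x r).rarr = s.rarr := rfl
@[simp] theorem State.putI_ireg : (s.putI x k).ireg y = if y = x then k else s.ireg y := by
  simp [State.putI, Function.update_apply]
@[simp] theorem State.putI_rreg : (s.putI x k).rreg = s.rreg := rfl
@[simp] theorem State.putI_rarr : (s.putI x k).rarr = s.rarr := rfl
@[simp] theorem State.putA_ireg : (s.putA x k r).ireg = s.ireg := rfl
@[simp] theorem State.putA_rreg : (s.putA x k r).rreg = s.rreg := rfl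
@[simp] theorem State.putA_rarr (m : ℕ) : (s.putA x k r).rarr y m =
    if y = x ∧ m = k then r else s.rarr y m := by
  by_cases h : y = x
  · subst h
    simp [State.putA, Function.update_apply]
  · simp [State.putA, h]

end Projections

/-- A straight-line program. -/
def code : List Instr → Prog
  | [] => .skip
  | c :: cs => .seq (.op c) (code cs)

/-- A straight-line program runs without failure and ends in a state that satisfies `Q`. -/
def Post (d : Fin n → Fin n → ℝ) (M : ℕ) : List Instr → State → (State → Prop) → Prop
  | [], s, Q => Q s
  | c :: cs, s, Q => ∃ s', c.step d M s = some s' ∧ Post d M cs s' Q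

section Post

variable {cs : List Instr} {s : State} {Q : State → Prop} {x y z A c : ℕ}

theorem exists_setI {P : State → Prop} {k : ℕ} :
    (∃ s', s.setI M x k = some s' ∧ P s') ↔ k ≤ M ∧ P (s.putI x k) := by
  rw [State.setI]
  split_ifs with h
  · simp [h, State.putI]
  · simp [h]

@[simp] theorem post_nil : Post d M [] s Q ↔ Q s := Iff.rfl
@[simp] theorem post_iconst : Post d M (.iconst x c :: cs) s Q ↔ c ≤ M ∧ Post d M cs (s.putI x c) Q :=
  exists_setI
@[simp] theorem post_iadd : Post d M (.iadd x y z :: cs) s Q ↔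
    s.ireg y + s.ireg z ≤ M ∧ Post d M cs (s.putI x (s.ireg y + s.ireg z)) Q := exists_setI
@[simp] theorem post_isub : Post d M (.isub x y z :: cs) s Q ↔
    s.ireg y - s.ireg z ≤ M ∧ Post d M cs (s.putI x (s.ireg y - s.ireg z)) Q := exists_setI
@[simp] theorem post_ihalf : Post d M (.ihalf x y :: cs) s Q ↔
    s.ireg y / 2 ≤ M ∧ Post d M cs (s.putI x (s.ireg y / 2)) Q := exists_setI
@[simp] theorem post_radd : Post d M (.radd x y z :: cs) s Q ↔
    Post d M cs (s.setR x (s.rreg y + s.rreg z)) Q := by simp [Post, Instr.step]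
@[simp] theorem post_rsub : Post d M (.rsub x y z :: cs) s Q ↔
    Post d M cs (s.setR x (s.rreg y - s.rreg z)) Q := by simp [Post, Instr.step]
@[simp] theorem post_rhalf : Post d M (.rhalf x y :: cs) s Q ↔
    Post d M cs (s.setR x (s.rreg y / 2)) Q := by simp [Post, Instr.step]
@[simp] theorem post_rload : Post d M (.rload x A y :: cs) s Q ↔
    Post d M cs (s.setR x (s.rarr A (s.ireg y))) Q := by simp [Post, Instr.step]
@[simp] theorem post_rstore : Post d M (.rstore A y x :: cs) s Q ↔
    Post d M cs (s.putA A (s.ireg y) (s.rreg x)) Q := by simp [Post, Instr.step, State.putA]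
@[simp] theorem post_dist : Post d M (.dist x y z :: cs) s Q ↔ ∃ h : s.ireg y < n ∧ s.ireg z < n,
    Post d M cs (s.setR x (d ⟨s.ireg y, h.1⟩ ⟨s.ireg z, h.2⟩)) Q := by
  rw [Post, Instr.step]
  split_ifs with h
  · simp [h]
  · simp [h]

end Post

namespace Run

variable {p q : Prog} {s : State} {T U : ℕ} {Q R : State → Prop}

theorem mono (h : Run d M p s T Q) (hT : T ≤ U) (hQ : ∀ s', Q s' → R s') : Run d M p s U R := by
  obtain ⟨s', t, he, ht, hq⟩ := h
  exact ⟨s', t, he, ht.trans hT, hQ _ hq⟩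

theorem skip (h : Q s) : Run d M .skip s 1 Q := ⟨s, 1, .skip s, le_rfl, h⟩

/-- The extra step pays for the `.skip` that ends every `code`. -/
theorem code {cs : List Instr} (h : Post d M cs s Q) :
    Run d M (code cs) s (cs.length + 1) Q := by
  induction cs generalizing s with
  | nil => exact skip h
  | cons c cs ih =>
    obtain ⟨s', hs, h⟩ := h
    obtain ⟨s₂, t, he, ht, hq⟩ := ih h
    exact ⟨s₂, 1 + t, .seq (.op hs) he, by simp only [List.length_cons]; omega, hq⟩

theorem seq (h : Run d M p s T (fun s' => Run d M q s' U Q)) : Run d M (.seq p q) s (T + U) Q := by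
  obtain ⟨s', t, he, ht, s₂, u, he', hu, hq⟩ := h
  exact ⟨s₂, t + u, .seq he he', by omega, hq⟩

/-- Run `p`, then run `q` from any state that satisfies the postcondition of `p`. -/
theorem andThen (h : Run d M p s T R) (h' : ∀ s', R s' → Run d M q s' U Q) :
    Run d M (.seq p q) s (T + U) Q :=
  (h.mono le_rfl h').seq

theorem branch {b : Test} (h : b.holds s → Run d M p s T Q) (h' : ¬ b.holds s → Run d M q s U Q) :
    Run d M (.branch b p q) s (max T U + 1) Q := by
  by_cases hb : b.holds s
  · obtain ⟨s', t, he, ht, hq⟩ := h hb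
    exact ⟨s', t + 1, .branch_true hb he, by omega, hq⟩
  · obtain ⟨s', t, he, ht, hq⟩ := h' hb
    exact ⟨s', t + 1, .branch_false hb he, by omega, hq⟩

/-- A loop whose invariant `I` is parametrized by a rank that decreases with each round. -/
theorem loop {b : Test} {I : ℕ → State → Prop} (hend : ∀ s, I 0 s → ¬ b.holds s)
    (hstep : ∀ m s, I (m + 1) s → b.holds s → Run d M p s T (I m)) {m : ℕ} (h : I m s) :
    Run d M (.loop b p) s ((T + 1) * m + 1) (fun s' => ¬ b.holds s' ∧ ∃ k, I k s') := by
  induction m generalizing s with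
  | zero => exact ⟨s, 1, .loop_false (hend s h), by omega, hend s h, 0, h⟩
  | succ m ih =>
    by_cases hb : b.holds s
    · obtain ⟨s', t, he, ht, hi⟩ := hstep m s h hb
      obtain ⟨s₂, u, he', hu, hq⟩ := ih hi
      exact ⟨s₂, t + u + 1, .loop_true hb he he', by rw [Nat.mul_succ]; omega, hq⟩
    · exact ⟨s, 1, .loop_false hb, by omega, hb, _, h⟩

end Run

end RealRAM

/-! ## Distances in an augmented path, in terms of positions on a line -/

namespace AugPath

/-- The positions `x 0 = 0 < x 1 < ⋯ < x (n-1)` of the vertices along the path, together with a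
shortcut of length `e` between the vertices `i ≤ j`. -/
structure Shortcut (x : ℕ → ℝ) (n i j : ℕ) (e : ℝ) : Prop where
  zero : x 0 = 0
  strict : ∀ k l, k < l → l < n → x k < x l
  le : i ≤ j
  lt : j < n
  nonneg : 0 ≤ e
  short : e ≤ x j - x i

/-- Distance between the positions `z` and `y` of the path, with a shortcut of length `e` between
the positions `p` and `q`. -/
noncomputable def lineDist (p q e z y : ℝ) : ℝ :=
  min |z - y| (min (|z - p| + e + |q - y|) (|z - q| + e + |p - y|))

/-- Distance between the point of the shortcut at distance `t` from `p` and the position `y`. -/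
noncomputable def shortcutDist (p q e t y : ℝ) : ℝ :=
  min (t + |p - y|) (e - t + |q - y|)

/-- `r` is a lower bound of the eccentricities of all points. -/
def IsLowerBound (x : ℕ → ℝ) (n i j : ℕ) (e r : ℝ) : Prop :=
  (∀ z, 0 ≤ z → z ≤ x (n - 1) → ∃ l < n, r ≤ lineDist (x i) (x j) e z (x l)) ∧
  (∀ t, 0 ≤ t → t ≤ e → ∃ l < n, r ≤ shortcutDist (x i) (x j) e t (x l))

/-- Some vertex is at distance at least `r` from the point with coordinate `θ` on the cycle. -/
def Far (x : ℕ → ℝ) (n i j : ℕ) (e r θ : ℝ) : Prop :=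
  (∃ l, i ≤ l ∧ l ≤ j ∧ r ≤ |θ - x l| ∧ |θ - x l| ≤ x j - x i + e - r) ∨
  (r - x i ≤ θ - x i ∧ θ - x i ≤ x j - x i + e - (r - x i)) ∨
  (r - (x (n - 1) - x j) ≤ |θ - x j| ∧ |θ - x j| ≤ x j - x i + e - (r - (x (n - 1) - x j)))

/-- All vertices are at distance at most `r` from the point with coordinate `θ` on the cycle. -/
def Near (x : ℕ → ℝ) (n i j : ℕ) (e r θ : ℝ) : Prop :=
  (∀ l, i ≤ l → l ≤ j → |θ - x l| ≤ r ∨ x j - x i + e - r ≤ |θ - x l|) ∧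
  (x i + (θ - x i) ≤ r ∨ x j - x i + e + x i - r ≤ θ - x i) ∧
  (x (n - 1) - x j + |θ - x j| ≤ r ∨
    x j - x i + e + (x (n - 1) - x j) - r ≤ |θ - x j|)

/-- The largest distance from the vertex `i` to the vertices that do not precede it is `R`. -/
def IsReachRight (x : ℕ → ℝ) (n i j : ℕ) (e R : ℝ) : Prop :=
  (∃ l < n, i ≤ l ∧ R ≤ lineDist (x i) (x j) e (x i) (x l)) ∧
  ∀ l < n, i ≤ l → lineDist (x i) (x j) e (x i) (x l) ≤ R

/-- The largest distance from the vertex `j` to the vertices that do not follow it is `R`. -/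
def IsReachLeft (x : ℕ → ℝ) (i j : ℕ) (e R : ℝ) : Prop :=
  (∃ l ≤ j, R ≤ lineDist (x i) (x j) e (x j) (x l)) ∧
  ∀ l ≤ j, lineDist (x i) (x j) e (x j) (x l) ≤ R

/-- `k` is the last of the first `n` indices whose position is at most `c`. -/
structure IsLast (x : ℕ → ℝ) (n : ℕ) (c : ℝ) (k : ℕ) : Prop where
  lt : k < n
  le : x k ≤ c
  next : k + 1 < n → c < x (k + 1)

variable {x : ℕ → ℝ} {n i j : ℕ} {e r : ℝ}

namespace Shortcut

variable (h : Shortcut x n i j e)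
include h

theorem mono {k l : ℕ} (hkl : k ≤ l) (hl : l < n) : x k ≤ x l := by
  rcases hkl.eq_or_lt with rfl | hlt
  · exact le_rfl
  · exact (h.strict k l hlt hl).le

theorem nonneg_pos {l : ℕ} (hl : l < n) : 0 ≤ x l := h.zero ▸ h.mono (Nat.zero_le l) hl

theorem le_last {l : ℕ} (hl : l < n) : x l ≤ x (n - 1) := h.mono (by omega) (by omega)

/-- The witness is a vertex of the cycle or the end of a tail, according to the alternative of
`Far`. Each of the three routes in `lineDist` contains one of the two arcs between the points, and
`Far` bounds both arcs from below. -/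
theorem exists_le_lineDist_of_far {z : ℝ} (hz : x i ≤ z) (hz' : z ≤ x j)
    (hf : Far x n i j e r z) : ∃ l < n, r ≤ lineDist (x i) (x j) e z (x l) := by
  have hn := h.lt
  have h0 := h.zero
  have he := h.nonneg
  rcases hf with ⟨l, hil, hlj, h1, h2⟩ | ⟨h1, h2⟩ | ⟨h1, h2⟩
  · refine ⟨l, by omega, le_min h1 (le_min ?_ ?_)⟩
    · linarith [le_abs_self (z - x i), le_abs_self (x j - x l), neg_le_abs (z - x l)]
    · linarith [neg_le_abs (z - x j), neg_le_abs (x i - x l), le_abs_self (z - x l)]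
  · refine ⟨0, by omega, le_min ?_ (le_min ?_ ?_)⟩ <;> rw [h0]
    · linarith [le_abs_self (z - 0)]
    · linarith [le_abs_self (z - x i), le_abs_self (x j - 0), h.nonneg_pos (show i < n by have := h.le; omega)]
    · linarith [neg_le_abs (z - x j), le_abs_self (x i - 0)]
  · rw [abs_of_nonpos (by linarith)] at h1 h2
    refine ⟨n - 1, by omega, le_min ?_ (le_min ?_ ?_)⟩
    · linarith [neg_le_abs (z - x (n - 1))]
    · linarith [le_abs_self (z - x i), neg_le_abs (x j - x (n - 1))]
    · linarith [neg_le_abs (z - x j), neg_le_abs (x i - x (n - 1))]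

/-- The coordinate on the cycle runs along the path from `x i` to `x j` and then back along the
shortcut, so the point at distance `t` from `i` has coordinate `x j + e - t`. -/
theorem exists_le_shortcutDist_of_far {t : ℝ} (ht : 0 ≤ t) (ht' : t ≤ e)
    (hf : Far x n i j e r (x j + e - t)) : ∃ l < n, r ≤ shortcutDist (x i) (x j) e t (x l) := by
  have hn := h.lt
  have h0 := h.zero
  have hs := h.short
  rcases hf with ⟨l, hil, hlj, h1, h2⟩ | ⟨h1, h2⟩ | ⟨h1, h2⟩
  · rw [abs_of_nonneg (by linarith [h.mono hlj hn])] at h1 h2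
    refine ⟨l, by omega, le_min ?_ ?_⟩
    · linarith [neg_le_abs (x i - x l)]
    · linarith [le_abs_self (x j - x l)]
  · refine ⟨0, by omega, le_min ?_ ?_⟩ <;> rw [h0]
    · linarith [le_abs_self (x i - 0)]
    · linarith [le_abs_self (x j - 0)]
  · rw [abs_of_nonneg (by linarith)] at h1 h2
    refine ⟨n - 1, by omega, le_min ?_ ?_⟩
    · linarith [neg_le_abs (x i - x (n - 1))]
    · linarith [neg_le_abs (x j - x (n - 1))]

/-- A vertex on a tail is no farther from the cycle than the end of this tail, so the three clauses
of `Near` cover all vertices. -/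
theorem lineDist_le_of_near {z : ℝ} (hz : x i ≤ z) (hz' : z ≤ x j)
    (hf : Near x n i j e r z) {l : ℕ} (hl : l < n) : lineDist (x i) (x j) e z (x l) ≤ r := by
  have he := h.nonneg
  have hij := h.mono h.le h.lt
  obtain ⟨h1, h2, h3⟩ := hf
  have h0 := h.nonneg_pos hl
  have hX := h.le_last hl
  simp only [lineDist, min_le_iff]
  rcases le_or_gt l i with hli | hli
  · have := h.mono hli (h.le.trans_lt h.lt)
    rw [abs_of_nonneg (by linarith : 0 ≤ z - x l), abs_of_nonpos (by linarith : z - x j ≤ 0),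
      abs_of_nonneg (by linarith : 0 ≤ x i - x l)]
    rcases h2 with h2 | h2
    · left; linarith
    · right; right; linarith
  rcases le_or_gt l j with hlj | hlj
  · have hlj' := h.mono hlj h.lt
    have hli' := h.mono hli.le hl
    rw [abs_of_nonneg (by linarith : 0 ≤ z - x i), abs_of_nonpos (by linarith : z - x j ≤ 0),
      abs_of_nonneg (by linarith : 0 ≤ x j - x l), abs_of_nonpos (by linarith : x i - x l ≤ 0)]
    rcases h1 l hli.le hlj with h1 | h1
    · left; exact h1
    · rcases abs_cases (z - x l) with ⟨hc, _⟩ | ⟨hc, _⟩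
      · right; right; linarith
      · right; left; linarith
  · have := h.mono hlj.le hl
    rw [abs_of_nonpos (by linarith : z - x j ≤ 0)] at h3
    rw [abs_of_nonneg (by linarith : 0 ≤ z - x i), abs_of_nonpos (by linarith : z - x l ≤ 0),
      abs_of_nonpos (by linarith : x j - x l ≤ 0)]
    rcases h3 with h3 | h3
    · left; linarith
    · right; left; linarith

theorem shortcutDist_le_of_near {t : ℝ} (ht : 0 ≤ t) (ht' : t ≤ e)
    (hf : Near x n i j e r (x j + e - t)) {l : ℕ} (hl : l < n) :
    shortcutDist (x i) (x j) e t (x l) ≤ r := by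
  have hs := h.short
  have hij := h.mono h.le h.lt
  obtain ⟨h1, h2, h3⟩ := hf
  have h0 := h.nonneg_pos hl
  have hX := h.le_last hl
  simp only [shortcutDist, min_le_iff]
  rw [abs_of_nonneg (by linarith : 0 ≤ x j + e - t - x j)] at h3
  rcases le_or_gt l i with hli | hli
  · have := h.mono hli (h.le.trans_lt h.lt)
    rw [abs_of_nonneg (by linarith : 0 ≤ x j - x l), abs_of_nonneg (by linarith : 0 ≤ x i - x l)]
    rcases h2 with h2 | h2
    · right; linarith
    · left; linarith
  rcases le_or_gt l j with hlj | hlj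
  · have hlj' := h.mono hlj h.lt
    have hli' := h.mono hli.le hl
    rw [abs_of_nonneg (by linarith : 0 ≤ x j - x l), abs_of_nonpos (by linarith : x i - x l ≤ 0)]
    have h1 := h1 l hli.le hlj
    rw [abs_of_nonneg (by linarith : 0 ≤ x j + e - t - x l)] at h1
    rcases h1 with h1 | h1
    · right; linarith
    · left; linarith
  · have := h.mono hlj.le hl
    rw [abs_of_nonpos (by linarith : x i - x l ≤ 0), abs_of_nonpos (by linarith : x j - x l ≤ 0)]
    rcases h3 with h3 | h3
    · right; linarith
    · left; linarith

/-! ### Reaches -/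

theorem lineDist_left {y : ℝ} (hy : x i ≤ y) :
    lineDist (x i) (x j) e (x i) y = min (y - x i) (e + |x j - y|) := by
  have he := h.nonneg
  have hij := h.mono h.le h.lt
  rw [lineDist, ← min_assoc, min_eq_left, sub_self, abs_zero, zero_add, abs_sub_comm,
    abs_of_nonneg (by linarith)]
  refine (min_le_left _ _).trans ?_
  rw [abs_sub_comm]
  linarith [abs_nonneg (x i - x j)]

theorem lineDist_right {y : ℝ} (hy : y ≤ x j) :
    lineDist (x i) (x j) e (x j) y = min (x j - y) (e + |x i - y|) := by
  have he := h.nonneg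
  have hij := h.mono h.le h.lt
  rw [lineDist, min_comm (|x j - x i| + e + _), ← min_assoc, min_eq_left, sub_self, abs_zero,
    zero_add, abs_of_nonneg (by linarith : 0 ≤ x j - y)]
  exact (min_le_left _ _).trans (by linarith [abs_nonneg (x j - x i)])

theorem le_reachRight {R : ℝ} (hR : IsReachRight x n i j e R) : e + (x (n - 1) - x j) ≤ R := by
  have hn := h.lt
  have hX := h.le_last hn
  have hij := h.mono h.le h.lt
  have hs := h.short
  refine le_trans ?_ (hR.2 (n - 1) (by omega) (by have := h.le; omega))
  rw [h.lineDist_left (by linarith), abs_of_nonpos (by linarith)]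
  exact le_min (by linarith) (by linarith)

theorem le_reachLeft {R : ℝ} (hR : IsReachLeft x i j e R) : e + x i ≤ R := by
  have hij := h.mono h.le h.lt
  have hs := h.short
  have h0 := h.nonneg_pos (h.le.trans_lt h.lt)
  refine le_trans ?_ (hR.2 0 (Nat.zero_le _))
  rw [h.zero, h.lineDist_right (by linarith), abs_of_nonneg (by linarith)]
  exact le_min (by linarith) (by linarith)

/-- Two points of a cycle are at most half its length apart, and every vertex from `j` on is reached
through the shortcut. -/
theorem reachRight_le {R : ℝ} (hR : IsReachRight x n i j e R) :
    R ≤ max (e + (x (n - 1) - x j)) ((x j - x i + e) / 2) := by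
  obtain ⟨⟨l, hl, hil, hR⟩, -⟩ := hR
  refine hR.trans ?_
  rw [h.lineDist_left (h.mono hil hl)]
  have hX := h.le_last hl
  rcases le_or_gt l j with hlj | hlj
  · rw [abs_of_nonneg (by linarith [h.mono hlj h.lt])]
    refine le_max_of_le_right ?_
    rcases le_total (x l - x i) ((x j - x i + e) / 2) with hc | hc
    · exact min_le_of_left_le hc
    · exact min_le_of_right_le (by linarith)
  · rw [abs_of_nonpos (by linarith [h.mono hlj.le hl])]
    exact le_max_of_le_left (min_le_of_right_le (by linarith))

theorem reachLeft_le {R : ℝ} (hR : IsReachLeft x i j e R) :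
    R ≤ max (e + x i) ((x j - x i + e) / 2) := by
  obtain ⟨⟨l, hl, hR⟩, -⟩ := hR
  refine hR.trans ?_
  rw [h.lineDist_right (h.mono hl h.lt)]
  have hX := h.nonneg_pos (hl.trans_lt h.lt)
  rcases le_or_gt i l with hlj | hlj
  · rw [abs_of_nonpos (by linarith [h.mono hlj (hl.trans_lt h.lt)])]
    refine le_max_of_le_right ?_
    rcases le_total (x j - x l) ((x j - x i + e) / 2) with hc | hc
    · exact min_le_of_left_le hc
    · exact min_le_of_right_le (by linarith)
  · rw [abs_of_nonneg (by linarith [h.mono hlj.le (h.le.trans_lt h.lt)])]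
    exact le_max_of_le_left (min_le_of_right_le (by linarith))

/-- The vertex `i` separates its tail from the rest of the graph. -/
theorem lineDist_eq_of_le {z y : ℝ} (hz : z ≤ x i) (hy : x i ≤ y) :
    lineDist (x i) (x j) e z y = x i - z + lineDist (x i) (x j) e (x i) y := by
  have he := h.nonneg
  have hij := h.mono h.le h.lt
  rw [h.lineDist_left hy, lineDist, ← min_assoc, min_eq_left, ← min_add_add_left]
  · rw [abs_of_nonpos (by linarith : z - y ≤ 0), abs_of_nonpos (by linarith : z - x i ≤ 0)]
    congr 1 <;> ring
  · refine (min_le_left _ _).trans ?_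
    rw [abs_of_nonpos (by linarith : z - y ≤ 0), abs_of_nonpos (by linarith : z - x j ≤ 0),
      abs_of_nonpos (by linarith : x i - y ≤ 0)]
    linarith

theorem lineDist_eq_of_ge {z y : ℝ} (hz : x j ≤ z) (hy : y ≤ x j) :
    lineDist (x i) (x j) e z y = z - x j + lineDist (x i) (x j) e (x j) y := by
  have he := h.nonneg
  have hij := h.mono h.le h.lt
  rw [h.lineDist_right hy, lineDist, min_comm (|z - x i| + e + _), ← min_assoc, min_eq_left,
    ← min_add_add_left]
  · rw [abs_of_nonneg (by linarith : 0 ≤ z - y), abs_of_nonneg (by linarith : 0 ≤ z - x j)]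
    congr 1 <;> ring
  · refine (min_le_left _ _).trans ?_
    rw [abs_of_nonneg (by linarith : 0 ≤ z - y), abs_of_nonneg (by linarith : 0 ≤ z - x i),
      abs_of_nonneg (by linarith : 0 ≤ x j - y)]
    linarith

/-! ### Optimality -/

/-- If neither tail reaches farther than the rest, then it suffices to bound the eccentricities of
the points of the cycle. -/
theorem isLowerBound_of_far {R R' : ℝ} (hR : IsReachRight x n i j e R)
    (hR' : IsReachLeft x i j e R') (ha : x i < R) (hb : x (n - 1) - x j < R')
    (hf : ∀ θ, x i ≤ θ → θ ≤ x j + e → Far x n i j e r θ) : IsLowerBound x n i j e r := by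
  have he := h.nonneg
  have hij := h.mono h.le h.lt
  have hi : i < n := h.le.trans_lt h.lt
  -- Apply the bound at the vertex `i` itself. A far vertex that precedes `i` would give only `r ≤ x
  -- i`, which is still below `R`.
  have hRr : r ≤ R := by
    obtain ⟨l, hl, hr⟩ := h.exists_le_lineDist_of_far le_rfl hij (hf _ le_rfl (by linarith))
    rcases le_total i l with hil | hil
    · exact hr.trans (hR.2 l hl hil)
    · refine hr.trans ((min_le_left _ _).trans ?_)
      rw [abs_of_nonneg (by linarith [h.mono hil hi])]
      linarith [h.nonneg_pos hl]
  have hRr' : r ≤ R' := by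
    obtain ⟨l, hl, hr⟩ := h.exists_le_lineDist_of_far hij le_rfl (hf _ hij (by linarith))
    rcases le_total l j with hil | hil
    · exact hr.trans (hR'.2 l hil)
    · refine hr.trans ((min_le_left _ _).trans ?_)
      rw [abs_of_nonpos (by linarith [h.mono hil hl])]
      linarith [h.le_last hl]
  refine ⟨fun z hz hz' => ?_, fun t ht ht' =>
    h.exists_le_shortcutDist_of_far ht ht' (hf _ (by linarith) (by linarith))⟩
  rcases le_total z (x i) with hzi | hzi
  · obtain ⟨l, hl, hil, hl'⟩ := hR.1
    exact ⟨l, hl, by rw [h.lineDist_eq_of_le hzi (h.mono hil hl)]; linarith⟩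
  rcases le_total z (x j) with hzj | hzj
  · exact h.exists_le_lineDist_of_far hzi hzj (hf _ hzi (by linarith))
  · obtain ⟨l, hl, hl'⟩ := hR'.1
    exact ⟨l, hl.trans_lt h.lt, by rw [h.lineDist_eq_of_ge hzj (h.mono hl h.lt)]; linarith⟩

/-- On the tail, vertex 0 and a vertex that realizes `R` are at total distance at least `x i + R`,
so one of them is at least half of this away. A point off the tail is at distance at least `x i ≥ (x
i + R) / 2` from vertex 0. -/
theorem isLowerBound_of_reachRight_le {R : ℝ} (hR : IsReachRight x n i j e R) (hRa : R ≤ x i) :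
    IsLowerBound x n i j e ((x i + R) / 2) := by
  have he := h.nonneg
  have hij := h.mono h.le h.lt
  have hn := h.lt
  refine ⟨fun z hz hz' => ?_, fun t ht ht' => ⟨0, by omega, ?_⟩⟩
  · rcases le_total z (x i) with hzi | hzi
    · rcases le_total ((x i + R) / 2) z with hc | hc
      · refine ⟨0, by omega, ?_⟩
        rw [h.zero]
        refine le_min ?_ (le_min ?_ ?_)
        · linarith [le_abs_self (z - 0)]
        · linarith [neg_le_abs (z - x i), le_abs_self (x j - 0)]
        · linarith [neg_le_abs (z - x j), le_abs_self (x i - 0)]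
      · obtain ⟨l, hl, hil, hl'⟩ := hR.1
        exact ⟨l, hl, by rw [h.lineDist_eq_of_le hzi (h.mono hil hl)]; linarith⟩
    · refine ⟨0, by omega, ?_⟩
      rw [h.zero]
      refine le_min ?_ (le_min ?_ ?_)
      · linarith [le_abs_self (z - 0)]
      · linarith [le_abs_self (z - x i), le_abs_self (x j - 0)]
      · linarith [abs_nonneg (z - x j), le_abs_self (x i - 0)]
  · rw [h.zero]
    exact le_min (by linarith [le_abs_self (x i - 0)]) (by linarith [le_abs_self (x j - 0)])

theorem lineDist_le_of_reachRight_le {R : ℝ} (hR : IsReachRight x n i j e R) (hRa : R ≤ x i)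
    {l : ℕ} (hl : l < n) : lineDist (x i) (x j) e ((x i + R) / 2) (x l) ≤ (x i + R) / 2 := by
  have he := h.nonneg
  have hX := h.le_last h.lt
  have hR0 := h.le_reachRight hR
  rcases le_total i l with hil | hil
  · rw [h.lineDist_eq_of_le (by linarith) (h.mono hil hl)]
    linarith [hR.2 l hl hil]
  · refine (min_le_left _ _).trans ?_
    have := h.mono hil (h.le.trans_lt h.lt)
    have := h.nonneg_pos hl
    rw [abs_le]
    constructor <;> linarith

theorem isLowerBound_of_reachLeft_le {R : ℝ} (hR : IsReachLeft x i j e R)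
    (hRb : R ≤ x (n - 1) - x j) : IsLowerBound x n i j e ((x (n - 1) - x j + R) / 2) := by
  have he := h.nonneg
  have hij := h.mono h.le h.lt
  have hn := h.lt
  refine ⟨fun z hz hz' => ?_, fun t ht ht' => ⟨n - 1, by omega, ?_⟩⟩
  · rcases le_total (x j) z with hzi | hzi
    · rcases le_total ((x (n - 1) - x j + R) / 2) (x (n - 1) - z) with hc | hc
      · refine ⟨n - 1, by omega, le_min ?_ (le_min ?_ ?_)⟩
        · linarith [neg_le_abs (z - x (n - 1))]
        · linarith [le_abs_self (z - x i), neg_le_abs (x j - x (n - 1))]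
        · linarith [le_abs_self (z - x j), neg_le_abs (x i - x (n - 1))]
      · obtain ⟨l, hl, hl'⟩ := hR.1
        exact ⟨l, hl.trans_lt hn, by rw [h.lineDist_eq_of_ge hzi (h.mono hl hn)]; linarith⟩
    · refine ⟨n - 1, by omega, le_min ?_ (le_min ?_ ?_)⟩
      · linarith [neg_le_abs (z - x (n - 1))]
      · linarith [abs_nonneg (z - x i), neg_le_abs (x j - x (n - 1))]
      · linarith [abs_nonneg (z - x j), neg_le_abs (x i - x (n - 1))]
  · exact le_min (by linarith [neg_le_abs (x i - x (n - 1))])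
      (by linarith [neg_le_abs (x j - x (n - 1))])

theorem lineDist_le_of_reachLeft_le {R : ℝ} (hR : IsReachLeft x i j e R)
    (hRb : R ≤ x (n - 1) - x j) {l : ℕ} (hl : l < n) :
    lineDist (x i) (x j) e (x (n - 1) - (x (n - 1) - x j + R) / 2) (x l) ≤
      (x (n - 1) - x j + R) / 2 := by
  have he := h.nonneg
  have hX := h.nonneg_pos (h.le.trans_lt h.lt)
  have hR0 := h.le_reachLeft hR
  rcases le_total l j with hil | hil
  · rw [h.lineDist_eq_of_ge (by linarith) (h.mono hil h.lt)]
    linarith [hR.2 l hil]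
  · refine (min_le_left _ _).trans ?_
    have := h.mono hil hl
    have := h.le_last hl
    rw [abs_le]
    constructor <;> linarith

/-! ### The tails cover the cycle -/

/-- The distances of a point of the cycle to `i` and `j` add up to at least `e`, as both arcs
between these vertices have length at least `e`. So the distances to the two tail ends add up to at
least twice the bound. -/
theorem far_of_cover {θ : ℝ} (h1 : x i ≤ θ) (h2 : θ ≤ x j + e) :
    Far x n i j e ((x i + (x (n - 1) - x j) + e) / 2) θ := by
  have hs := h.short
  by_contra hc
  simp only [Far, not_or, not_and_or, not_le] at hc
  obtain ⟨-, hc1, hc2⟩ := hc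
  rcases abs_cases (θ - x j) with ⟨ha, _⟩ | ⟨ha, _⟩ <;> rw [ha] at hc2 <;>
    rcases hc1 with hc1 | hc1 <;> rcases hc2 with hc2 | hc2 <;> linarith

/-- The point is the midpoint of the route from one tail end to the other through the shortcut.
Vertices of the cycle are within half the length of the cycle, and `hL` makes this at most the
radius; `ha` keeps the point on the shortcut side of `j`. -/
theorem near_of_cover (hL : x j - x i ≤ x i + (x (n - 1) - x j))
    (ha : x (n - 1) - x j ≤ x i + e) :
    Near x n i j e ((x i + (x (n - 1) - x j) + e) / 2)
      (x j + e - (x (n - 1) - x j + e - x i) / 2) := by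
  refine ⟨fun l _ hlj => ?_, Or.inr (by linarith), Or.inl ?_⟩
  · have := h.mono hlj h.lt
    rw [abs_of_nonneg (by linarith)]
    rcases le_total (x j + e - (x (n - 1) - x j + e - x i) / 2 - x l)
      ((x j - x i + e) / 2) with hc | hc
    · left; linarith
    · right; linarith
  · rw [abs_of_nonneg (by linarith)]
    linarith

/-! ### A gap remains on the cycle -/

/-- Every position of the path is within `ρ` of a vertex of the cycle or of a position that is
covered by a tail, and so is every point of the shortcut. -/
theorem far_of_gaps {ρ A B θ : ℝ} (hρ : 0 ≤ ρ)
    (hA : A ≤ x i + x i ∨ A ≤ x i + (x (n - 1) - x j) - e)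
    (hB : x j - (x (n - 1) - x j) ≤ B ∨ x j + e - x i ≤ B)
    (hpath : ∀ φ, A ≤ φ → φ ≤ B →
      φ - A ≤ ρ ∨ B - φ ≤ ρ ∨ ∃ l, i ≤ l ∧ l ≤ j ∧ |φ - x l| ≤ ρ)
    (hedge : e - x i - (x (n - 1) - x j) ≤ 2 * ρ) (h1 : x i ≤ θ) (h2 : θ ≤ x j + e) :
    Far x n i j e ((x j - x i + e) / 2 - ρ) θ := by
  have hs := h.short
  have he := h.nonneg
  have hij := h.mono h.le h.lt
  have hX := h.le_last h.lt
  -- `φ` is the antipode of `θ`: the shift by half the length, forwards or backwards, that stays in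
  -- the range of coordinates.
  obtain ⟨φ, hφ, hφ1, hφ2⟩ : ∃ φ, (θ = φ + (x j - x i + e) / 2 ∨ θ = φ - (x j - x i + e) / 2) ∧
      x i ≤ φ ∧ φ ≤ x j + e := by
    rcases le_total θ (x i + (x j - x i + e) / 2) with hc | hc
    · exact ⟨θ + (x j - x i + e) / 2, Or.inr (by ring), by linarith, by linarith⟩
    · exact ⟨θ - (x j - x i + e) / 2, Or.inl (by ring), by linarith, by linarith⟩
  -- If the antipode is within `ρ + x i` of `i` along the cycle, the end of the left tail is far;
  -- `hright` is the same for the other tail.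
  have hleft : φ - x i ≤ ρ + x i ∨ x j - x i + e - ρ - x i ≤ φ - x i →
      Far x n i j e ((x j - x i + e) / 2 - ρ) θ := by
    intro hc
    refine Or.inr (Or.inl ?_)
    constructor <;> rcases hφ with rfl | rfl <;> rcases hc with hc | hc <;> linarith
  have hright : |φ - x j| ≤ ρ + (x (n - 1) - x j) ∨
      x j - x i + e - ρ - (x (n - 1) - x j) ≤ |φ - x j| →
      Far x n i j e ((x j - x i + e) / 2 - ρ) θ := by
    intro hc
    refine Or.inr (Or.inr ?_)
    rcases abs_cases (φ - x j) with ⟨hd, hd'⟩ | ⟨hd, hd'⟩ <;> rw [hd] at hc <;>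
      rcases abs_cases (θ - x j) with ⟨hd, hd''⟩ | ⟨hd, hd''⟩ <;> rw [hd] <;>
      constructor <;> rcases hφ with rfl | rfl <;> rcases hc with hc | hc <;> linarith
  rcases lt_or_ge (x j) φ with hφj | hφj
  -- The antipode is on the shortcut. By `hedge` the two enlarged arcs around `i` and `j` leave no
  -- room between them there.
  · rcases le_total (φ - x j) (ρ + (x (n - 1) - x j)) with hc | hc
    · exact hright (Or.inl (by rwa [abs_of_nonneg (by linarith)]))
    · exact hleft (Or.inr (by linarith))
  rcases lt_or_ge φ A with hφA | hφA
  -- A position before `A` lies in the arc around `i`, or in the arc around `j` after that one has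
  -- run across the whole shortcut and past `i`.
  · rcases hA with hA | hA
    · exact hleft (Or.inl (by linarith))
    · exact hright (Or.inr (by rw [abs_of_nonpos (by linarith)]; linarith))
  rcases lt_or_ge B φ with hφB | hφB
  · rcases hB with hB | hB
    · exact hright (Or.inl (by rw [abs_of_nonpos (by linarith)]; linarith))
    · exact hleft (Or.inr (by linarith))
  rcases hpath φ hφA hφB with hc | hc | ⟨l, hil, hlj, hc⟩
  · rcases hA with hA | hA
    · exact hleft (Or.inl (by linarith))
    · exact hright (Or.inr (by rw [abs_of_nonpos (by linarith)]; linarith))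
  · rcases hB with hB | hB
    · exact hright (Or.inl (by rw [abs_of_nonpos (by linarith)]; linarith))
    · exact hleft (Or.inr (by linarith))
  · refine Or.inl ⟨l, hil, hlj, ?_⟩
    rw [abs_le] at hc
    have hlj' := h.mono hlj h.lt
    have hil' := h.mono hil (hlj.trans_lt h.lt)
    rcases abs_cases (θ - x l) with ⟨hd, hd''⟩ | ⟨hd, hd''⟩ <;> rw [hd] <;>
      constructor <;> rcases hφ with rfl | rfl <;> linarith

/-- The antipode of the midpoint of a gap on the path. -/
theorem near_of_gap {A B g w θ : ℝ} (hw : 0 ≤ w)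
    (hA1 : x i + x i ≤ A) (hA2 : x i + (x (n - 1) - x j) - e ≤ A)
    (hB1 : B ≤ x j - (x (n - 1) - x j)) (hB2 : B ≤ x j + e - x i)
    (hgA : A ≤ g) (hgB : g + w ≤ B)
    (hfree : ∀ l, i ≤ l → l ≤ j → x l ≤ g ∨ g + w ≤ x l)
    (hθ : θ = g + w / 2 + (x j - x i + e) / 2 ∨ θ = g + w / 2 - (x j - x i + e) / 2)
    (h1 : x i ≤ θ) (h2 : θ ≤ x j + e) :
    Near x n i j e ((x j - x i + e) / 2 - w / 2) θ := by
  have hX := h.le_last h.lt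
  have h0 := h.nonneg_pos (h.le.trans_lt h.lt)
  refine ⟨fun l hil hlj => ?_, ?_, ?_⟩
  · have hlj' := h.mono hlj h.lt
    have hil' := h.mono hil (hlj.trans_lt h.lt)
    rcases abs_cases (θ - x l) with ⟨hd, hd''⟩ | ⟨hd, hd''⟩ <;> rw [hd] <;>
      rcases hfree l hil hlj with hc | hc <;> rcases hθ with rfl | rfl <;>
      first | (left; linarith) | (right; linarith)
  · rcases hθ with rfl | rfl
    · right; linarith
    · left; linarith
  · rcases abs_cases (θ - x j) with ⟨hd, hd''⟩ | ⟨hd, hd''⟩ <;> rw [hd] <;>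
      rcases hθ with rfl | rfl <;> first | (left; linarith) | (right; linarith)

/-- The antipode of the midpoint of a gap on the shortcut. -/
theorem near_of_shortcut_gap {w : ℝ} (hw : 0 ≤ w) (hwe : w = e - x i - (x (n - 1) - x j)) :
    Near x n i j e ((x j - x i + e) / 2 - w / 2)
      (x j + (x (n - 1) - x j) + w / 2 - (x j - x i + e) / 2) := by
  have hs := h.short
  have hX := h.le_last h.lt
  have h0 := h.nonneg_pos (h.le.trans_lt h.lt)
  refine ⟨fun l hil hlj => Or.inl ?_, Or.inl (by linarith), Or.inl ?_⟩
  · have hlj' := h.mono hlj h.lt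
    have hil' := h.mono hil (hlj.trans_lt h.lt)
    rw [abs_le]
    constructor <;> linarith
  · rw [abs_of_nonpos (by linarith)]
    linarith

/-- This says that the two arcs leave an interval of positive length on the path between `i` and
`j`. The terms with `- e` are the parts of an arc that reach across the shortcut. Their bounds come
from `ha` and `hb`, combined with the upper bounds on the reaches. -/
theorem add_lt_of_reach {R R' : ℝ} (hR : IsReachRight x n i j e R)
    (hR' : IsReachLeft x i j e R') (ha : x i < R) (hb : x (n - 1) - x j < R')
    (hL : x i + (x (n - 1) - x j) < x j - x i) :
    max (x i) (x (n - 1) - x j - e) + max (x (n - 1) - x j) (x i - e) < x j - x i := by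
  have hr := h.reachRight_le hR
  have hr' := h.reachLeft_le hR'
  have he := h.nonneg
  rcases max_cases (x i) (x (n - 1) - x j - e) with ⟨h1, _⟩ | ⟨h1, _⟩ <;>
    rcases max_cases (x (n - 1) - x j) (x i - e) with ⟨h2, _⟩ | ⟨h2, _⟩ <;> rw [h1, h2] <;>
    rcases le_max_iff.1 hr with hr | hr <;> rcases le_max_iff.1 hr' with hr' | hr' <;> linarith

/-- These inequalities place the midpoint between the two tail ends on the shortcut. -/
theorem le_add_of_reach {R R' : ℝ} (hR : IsReachRight x n i j e R)
    (hR' : IsReachLeft x i j e R') (ha : x i < R) (hb : x (n - 1) - x j < R')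
    (hL : x j - x i ≤ x i + (x (n - 1) - x j)) :
    x i ≤ x (n - 1) - x j + e ∧ x (n - 1) - x j ≤ x i + e := by
  have hr := h.reachRight_le hR
  have hr' := h.reachLeft_le hR'
  constructor
  · rcases le_max_iff.1 hr with hr | hr <;> linarith
  · rcases le_max_iff.1 hr' with hr' | hr' <;> linarith

end Shortcut

end AugPath

/-! ### Gaps between vertices, and reaches in terms of the last vertex before a position -/

namespace AugPath

/-- The interval of length `w` that starts at `g` lies between `A` and `B` and has no vertex of the
cycle in its interior. -/
structure IsGap (x : ℕ → ℝ) (i j : ℕ) (A B g w : ℝ) : Prop where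
  nonneg : 0 ≤ w
  le_left : A ≤ g
  right_le : g + w ≤ B
  free : ∀ l, i ≤ l → l ≤ j → x l ≤ g ∨ g + w ≤ x l

/-- Every interval between consecutive elements among `A`, the vertices from `k₁ + 1` to `k₂`, and
`B` has length at most `w`. -/
def BoundsGaps (x : ℕ → ℝ) (A B : ℝ) (k₁ k₂ : ℕ) (w : ℝ) : Prop :=
  (k₂ ≤ k₁ → B - A ≤ w) ∧
  (k₁ < k₂ → x (k₁ + 1) - A ≤ w ∧ B - x k₂ ≤ w ∧ ∀ k, k₁ < k → k < k₂ → x (k + 1) - x k ≤ w)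

namespace Shortcut

variable {x : ℕ → ℝ} {n i j : ℕ} {e r : ℝ} (h : Shortcut x n i j e)
include h

theorem le_of_isLast {c : ℝ} {k l : ℕ} (hk : IsLast x n c k) (hl : l < n) (hc : x l ≤ c) :
    l ≤ k := by
  by_contra hlt
  push Not at hlt
  have := hk.next (by omega)
  linarith [h.mono (show k + 1 ≤ l by omega) hl]

theorem lt_of_isLast {c : ℝ} {k l : ℕ} (hk : IsLast x n c k) (hl : l < n) (hkl : k < l) :
    c < x l := by
  by_contra hc
  have := h.le_of_isLast hk hl (not_lt.1 hc)
  omega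

theorem isLast_le {c : ℝ} {k l : ℕ} (hk : IsLast x n c k) (hc : c ≤ x l) :
    k ≤ l := by
  by_contra hlt
  linarith [h.strict l k (by omega) hk.lt, hk.le]

/-- Up to `j` the distance from `i` is the minimum of an increasing and a decreasing function of the
position, which cross at `(x i + x j + e) / 2`. The maximum is therefore attained at one of the two
vertices next to the crossing. From `j` on, the last vertex is the farthest. -/
theorem isReachRight_of_isLast {k : ℕ} (hk : IsLast x n ((x i + x j + e) / 2) k) :
    IsReachRight x n i j e (max (e + (x (n - 1) - x j))
      (if k + 1 ≤ j then max (x k - x i) (e + x j - x (k + 1)) else x k - x i)) := by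
  have he := h.nonneg
  have hs := h.short
  have hn := h.lt
  have hij := h.mono h.le hn
  have hi := h.le.trans_lt hn
  have hX := h.le_last hn
  have hik : i ≤ k := h.le_of_isLast hk hi (by linarith)
  have hkj : k ≤ j := h.isLast_le hk (by linarith)
  have hkx := h.mono hkj hn
  have hik' := h.mono hik hk.lt
  constructor
  · rcases max_choice (e + (x (n - 1) - x j))
      (if k + 1 ≤ j then max (x k - x i) (e + x j - x (k + 1)) else x k - x i) with hm | hm
    · rw [hm]
      refine ⟨n - 1, by omega, by omega, ?_⟩
      rw [h.lineDist_left (by linarith), abs_of_nonpos (by linarith)]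
      exact le_min (by linarith) (by linarith)
    · have hat : ∃ l < n, i ≤ l ∧ x k - x i ≤ lineDist (x i) (x j) e (x i) (x l) := by
        refine ⟨k, hk.lt, hik, ?_⟩
        rw [h.lineDist_left hik', abs_of_nonneg (by linarith)]
        exact le_min le_rfl (by linarith [hk.le])
      rw [hm]
      split_ifs with hk1
      · rcases max_choice (x k - x i) (e + x j - x (k + 1)) with hm | hm <;> rw [hm]
        · exact hat
        · refine ⟨k + 1, by omega, by omega, ?_⟩
          have := h.mono hk1 hn
          have := hk.next (by omega)
          rw [h.lineDist_left (by linarith), abs_of_nonneg (by linarith)]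
          exact le_min (by linarith) (by linarith)
      · exact hat
  · intro l hl hil
    rw [h.lineDist_left (h.mono hil hl)]
    rcases le_or_gt j l with hjl | hjl
    · refine le_max_of_le_left (min_le_of_right_le ?_)
      rw [abs_of_nonpos (by linarith [h.mono hjl hl])]
      linarith [h.le_last hl]
    · refine le_max_of_le_right ?_
      rcases le_or_gt l k with hlk | hlk
      · have := h.mono hlk hk.lt
        split_ifs
        · exact min_le_of_left_le (le_max_of_le_left (by linarith))
        · exact min_le_of_left_le (by linarith)
      · have := h.mono (show k + 1 ≤ l from hlk) hl
        rw [if_pos (by omega)]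
        rw [abs_of_nonneg (by linarith [h.mono hjl.le hn])]
        exact min_le_of_right_le (le_max_of_le_right (by linarith))

/-- Mirror image of `isReachRight_of_isLast`: seen from `j`, the two functions cross at `(x i + x j
- e) / 2`, and vertex 0 is the farthest one up to `i`. -/
theorem isReachLeft_of_isLast {k : ℕ} (hk : IsLast x n ((x i + x j - e) / 2) k) :
    IsReachLeft x i j e (max (e + x i)
      (if k + 1 ≤ j then max (e + x k - x i) (x j - x (k + 1)) else e + x k - x i)) := by
  have he := h.nonneg
  have hs := h.short
  have hn := h.lt
  have hij := h.mono h.le hn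
  have hi := h.le.trans_lt hn
  have h0 := h.nonneg_pos hi
  have hik : i ≤ k := h.le_of_isLast hk hi (by linarith)
  have hkj : k ≤ j := h.isLast_le hk (by linarith)
  have hkx := h.mono hkj hn
  have hik' := h.mono hik hk.lt
  constructor
  · rcases max_choice (e + x i)
      (if k + 1 ≤ j then max (e + x k - x i) (x j - x (k + 1)) else e + x k - x i) with hm | hm
    · rw [hm]
      refine ⟨0, by omega, ?_⟩
      rw [h.zero, h.lineDist_right (by linarith), abs_of_nonneg (by linarith)]
      exact le_min (by linarith) (by linarith)
    · have hat : ∃ l ≤ j, e + x k - x i ≤ lineDist (x i) (x j) e (x j) (x l) := by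
        refine ⟨k, hkj, ?_⟩
        rw [h.lineDist_right hkx, abs_of_nonpos (by linarith)]
        exact le_min (by linarith [hk.le]) (by linarith)
      rw [hm]
      split_ifs with hk1
      · rcases max_choice (e + x k - x i) (x j - x (k + 1)) with hm | hm <;> rw [hm]
        · exact hat
        · refine ⟨k + 1, by omega, ?_⟩
          have := h.mono hk1 hn
          have := hk.next (by omega)
          rw [h.lineDist_right (by linarith), abs_of_nonpos (by linarith)]
          exact le_min (by linarith) (by linarith)
      · exact hat
  · intro l hlj
    rw [h.lineDist_right (h.mono hlj hn)]
    have hl := hlj.trans_lt hn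
    rcases le_or_gt l i with hil | hil
    · refine le_max_of_le_left (min_le_of_right_le ?_)
      rw [abs_of_nonneg (by linarith [h.mono hil hi])]
      linarith [h.nonneg_pos hl]
    · refine le_max_of_le_right ?_
      have := h.mono hil.le hl
      rcases le_or_gt l k with hlk | hlk
      · have := h.mono hlk hk.lt
        rw [abs_of_nonpos (by linarith)]
        split_ifs
        · exact min_le_of_right_le (le_max_of_le_left (by linarith))
        · exact min_le_of_right_le (by linarith)
      · have := h.mono (show k + 1 ≤ l from hlk) hl
        rw [if_pos (by omega)]
        exact min_le_of_left_le (le_max_of_le_right (by linarith))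

/-- A point of an interval of length at most `2 * ρ` is within `ρ` of one of its ends. This supplies
the hypothesis `hpath` of `far_of_gaps`. -/
theorem close_of_boundsGaps {A B w ρ φ : ℝ} {k₁ k₂ : ℕ} (hA : x i ≤ A) (hB : B ≤ x j)
    (h₁ : IsLast x n A k₁) (h₂ : IsLast x n B k₂) (hw : BoundsGaps x A B k₁ k₂ w)
    (hρ : w ≤ 2 * ρ) (hφA : A ≤ φ) (hφB : φ ≤ B) :
    φ - A ≤ ρ ∨ B - φ ≤ ρ ∨ ∃ l, i ≤ l ∧ l ≤ j ∧ |φ - x l| ≤ ρ := by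
  have hn := h.lt
  have hi := h.le.trans_lt hn
  have hik₁ : i ≤ k₁ := h.le_of_isLast h₁ hi hA
  have hk₂j : k₂ ≤ j := h.isLast_le h₂ hB
  rcases le_or_gt k₂ k₁ with hk | hk
  · have := hw.1 hk
    rcases le_total (φ - A) ρ with hc | hc
    · exact Or.inl hc
    · exact Or.inr (Or.inl (by linarith))
  obtain ⟨w1, w2, w3⟩ := hw.2 hk
  rcases le_or_gt (x k₂) φ with hc | hc
  · rcases le_total (B - φ) ρ with hd | hd
    · exact Or.inr (Or.inl hd)
    · exact Or.inr (Or.inr ⟨k₂, by omega, hk₂j, by rw [abs_le]; constructor <;> linarith⟩)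
  rcases le_or_gt φ (x (k₁ + 1)) with hc' | hc'
  · rcases le_total (φ - A) ρ with hd | hd
    · exact Or.inl hd
    · exact Or.inr (Or.inr ⟨k₁ + 1, by omega, by omega, by rw [abs_le]; constructor <;> linarith⟩)
  -- `k + 1` is the first index after `k₁` whose position exceeds `φ`.
  obtain ⟨k, hk1, hk2, hk3, hk4⟩ : ∃ k, k₁ < k ∧ k < k₂ ∧ x k ≤ φ ∧ φ < x (k + 1) := by
    classical
    have hex : ∃ m, k₁ < m ∧ φ < x m := ⟨k₂, hk, hc⟩
    obtain ⟨hm1, hm2⟩ := Nat.find_spec hex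
    have hm3 : Nat.find hex ≤ k₂ := Nat.find_min' hex ⟨hk, hc⟩
    have hm4 : Nat.find hex ≠ k₁ + 1 := fun heq => by rw [heq] at hm2; linarith
    refine ⟨Nat.find hex - 1, by omega, by omega, ?_, by rwa [Nat.sub_add_cancel (by omega)]⟩
    by_contra hcon
    exact Nat.find_min hex (show Nat.find hex - 1 < Nat.find hex by omega)
      ⟨by omega, not_le.1 hcon⟩
  have := w3 k hk1 hk2
  rcases le_total (φ - x k) ρ with hd | hd
  · exact Or.inr (Or.inr ⟨k, by omega, by omega, by rw [abs_le]; constructor <;> linarith⟩)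
  · exact Or.inr (Or.inr ⟨k + 1, by omega, by omega, by rw [abs_le]; constructor <;> linarith⟩)

end Shortcut

end AugPath

/-! ### From the metric to the line: shortest paths in the augmented path -/

namespace AugPath

/-- The axioms of a distance, for the finite array of distances between the vertices. -/
structure IsDist {n : ℕ} (d : Fin n → Fin n → ℝ) : Prop where
  self : ∀ a, d a a = 0
  pos : ∀ a b, a ≠ b → 0 < d a b
  symm : ∀ a b, d a b = d b a
  triangle : ∀ a b c, d a c ≤ d a b + d b c

/-- The length of the path edge that starts at the vertex `k`, or `0` if there is none. -/
noncomputable def pathEdge {n : ℕ} (d : Fin n → Fin n → ℝ) (k : ℕ) : ℝ :=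
  if h : k + 1 < n then d ⟨k, by omega⟩ ⟨k + 1, h⟩ else 0

/-- The position of the vertex `k` along the path. -/
noncomputable def pathPos {n : ℕ} (d : Fin n → Fin n → ℝ) (k : ℕ) : ℝ :=
  ∑ m ∈ Finset.range k, pathEdge d m

variable {n : ℕ} {d : Fin n → Fin n → ℝ}

theorem pathPos_zero : pathPos d 0 = 0 := by simp [pathPos]

theorem pathPos_succ (k : ℕ) : pathPos d (k + 1) = pathPos d k + pathEdge d k :=
  Finset.sum_range_succ _ _

theorem pathEdge_of_lt {k : ℕ} (h : k + 1 < n) :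
    pathEdge d k = d ⟨k, by omega⟩ ⟨k + 1, h⟩ := dif_pos h

theorem graph_comm (i j : Fin n) : graph i j = graph j i := by
  rw [graph, graph, SimpleGraph.edge_comm]

theorem graph_adj {i j a b : Fin n} : (graph i j).Adj a b ↔
    ((a : ℕ) + 1 = b ∨ (b : ℕ) + 1 = a) ∨ (((a = i ∧ b = j) ∨ (a = j ∧ b = i)) ∧ a ≠ b) := by
  rw [graph, SimpleGraph.sup_adj, SimpleGraph.pathGraph_adj, SimpleGraph.edge_adj]

namespace IsDist

variable (hd : IsDist d)
include hd

theorem nonneg (a b : Fin n) : 0 ≤ d a b := by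
  rcases eq_or_ne a b with rfl | h
  · exact (hd.self a).ge
  · exact (hd.pos a b h).le

theorem pathPos_lt {k l : ℕ} (hkl : k < l) (hl : l < n) : pathPos d k < pathPos d l := by
  induction l, hkl using Nat.le_induction with
  | base =>
    rw [pathPos_succ, pathEdge_of_lt hl]
    linarith [hd.pos ⟨k, by omega⟩ ⟨k + 1, hl⟩ (by simp [Fin.ext_iff])]
  | succ m hm ih =>
    rw [pathPos_succ, pathEdge_of_lt hl]
    linarith [ih (by omega), hd.nonneg ⟨m, by omega⟩ ⟨m + 1, hl⟩]

theorem le_pathPos_sub {k l : ℕ} (hkl : k ≤ l) (hl : l < n) :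
    d ⟨k, by omega⟩ ⟨l, hl⟩ ≤ pathPos d l - pathPos d k := by
  induction l, hkl using Nat.le_induction with
  | base => simp [hd.self]
  | succ m hm ih =>
    rw [pathPos_succ, pathEdge_of_lt hl]
    linarith [ih (by omega), hd.triangle ⟨k, by omega⟩ ⟨m, by omega⟩ ⟨m + 1, hl⟩]

theorem shortcut {i j : Fin n} (hij : i ≤ j) : Shortcut (pathPos d) n i j (d i j) where
  zero := pathPos_zero
  strict _ _ := hd.pathPos_lt
  le := hij
  lt := j.2
  nonneg := hd.nonneg i j
  short := hd.le_pathPos_sub hij j.2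

theorem eq_of_succ {a b : Fin n} (h : (a : ℕ) + 1 = b ∨ (b : ℕ) + 1 = a) :
    d a b = |pathPos d a - pathPos d b| := by
  obtain ⟨a, ha⟩ := a
  obtain ⟨b, hb⟩ := b
  rcases h with h | h <;> obtain rfl : _ = _ := h <;> simp only [pathPos_succ]
  · rw [pathEdge_of_lt hb, sub_add_cancel_left, abs_neg, abs_of_nonneg (hd.nonneg _ _)]
  · rw [pathEdge_of_lt ha, add_sub_cancel_left, abs_of_nonneg (hd.nonneg _ _), hd.symm]

theorem walkLength_nonneg {i j a b : Fin n} (w : (graph i j).Walk a b) : 0 ≤ walkLength d w := by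
  refine List.sum_nonneg ?_
  simp only [List.mem_map]
  rintro _ ⟨e, -, rfl⟩
  exact hd.nonneg _ _

/-- Induction on the walk: along an edge, `lineDist` to a fixed target drops by at most the length
of the edge. For the shortcut this uses that a second traversal never pays off. -/
theorem lineDist_le_walkLength {i j a b : Fin n} (w : (graph i j).Walk a b) :
    lineDist (pathPos d i) (pathPos d j) (d i j) (pathPos d a) (pathPos d b) ≤ walkLength d w := by
  have he := hd.nonneg i j
  induction w with
  | nil => simp [lineDist, walkLength]
  | @cons a b c hadj w ih =>
    have hlen : walkLength d (SimpleGraph.Walk.cons hadj w) = d a b + walkLength d w := by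
      simp [walkLength]
    rw [hlen]
    refine le_trans ?_ (add_le_add_right ih _)
    rw [graph_adj] at hadj
    rcases hadj with hadj | ⟨⟨rfl, rfl⟩ | ⟨rfl, rfl⟩, -⟩
    · rw [hd.eq_of_succ hadj, lineDist, lineDist, ← min_add_add_left, ← min_add_add_left]
      refine min_le_min ?_ (min_le_min ?_ ?_)
      · exact abs_sub_le _ _ _
      · linarith [abs_sub_le (pathPos d a) (pathPos d b) (pathPos d i)]
      · linarith [abs_sub_le (pathPos d a) (pathPos d b) (pathPos d j)]
    · simp only [lineDist, ← min_add_add_left, sub_self, abs_zero, zero_add]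
      refine le_min ?_ (le_min ?_ ?_)
      · exact (min_le_right _ _).trans (min_le_left _ _)
      · refine (min_le_right _ _).trans ((min_le_left _ _).trans ?_)
        linarith [abs_nonneg (pathPos d b - pathPos d a)]
      · exact (min_le_left _ _).trans (by linarith)
    · rw [hd.symm a b]
      simp only [lineDist, ← min_add_add_left, sub_self, abs_zero, zero_add]
      refine le_min ?_ (le_min ?_ ?_)
      · exact (min_le_right _ _).trans (min_le_right _ _)
      · exact (min_le_left _ _).trans (by linarith)
      · refine (min_le_right _ _).trans ((min_le_right _ _).trans ?_)
        linarith [abs_nonneg (pathPos d b - pathPos d a)]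

theorem exists_walk_add (i j : Fin n) (a m : ℕ) (h : a + m < n) :
    (∃ w : (graph i j).Walk ⟨a, by omega⟩ ⟨a + m, h⟩,
      walkLength d w = pathPos d (a + m) - pathPos d a) ∧
    ∃ w : (graph i j).Walk ⟨a + m, h⟩ ⟨a, by omega⟩,
      walkLength d w = pathPos d (a + m) - pathPos d a := by
  induction m with
  | zero => exact ⟨⟨.nil, by simp [walkLength]⟩, ⟨.nil, by simp [walkLength]⟩⟩
  | succ m ih =>
    obtain ⟨⟨w, hw⟩, w', hw'⟩ := ih (by omega)
    have hadj : (graph i j).Adj ⟨a + m, by omega⟩ ⟨a + (m + 1), h⟩ :=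
      graph_adj.2 (Or.inl (Or.inl (by simp; omega)))
    have hlen : d ⟨a + m, by omega⟩ ⟨a + (m + 1), h⟩ =
        pathPos d (a + (m + 1)) - pathPos d (a + m) := by
      rw [show pathPos d (a + (m + 1)) = _ from pathPos_succ (a + m),
        pathEdge_of_lt (k := a + m) h]
      exact (add_sub_cancel_left _ _).symm
    have hlen' := (hd.symm _ _).trans hlen
    constructor
    · refine ⟨w.append (.cons hadj .nil), ?_⟩
      simp only [walkLength, SimpleGraph.Walk.darts_append, SimpleGraph.Walk.darts_cons,
        SimpleGraph.Walk.darts_nil, List.map_append, List.sum_append, List.map_cons, List.map_nil,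
        List.sum_cons, List.sum_nil] at hw ⊢
      rw [hw, hlen]
      ring
    · refine ⟨.cons hadj.symm w', ?_⟩
      simp only [walkLength, SimpleGraph.Walk.darts_cons, List.map_cons, List.sum_cons] at hw' ⊢
      rw [hw', hlen']
      ring

theorem exists_walk (i j a b : Fin n) :
    ∃ w : (graph i j).Walk a b, walkLength d w = |pathPos d a - pathPos d b| := by
  obtain ⟨a, ha⟩ := a
  obtain ⟨b, hb⟩ := b
  rcases le_total a b with hab | hab <;> obtain ⟨m, rfl⟩ := Nat.exists_eq_add_of_le hab
  · obtain ⟨w, hw⟩ := (hd.exists_walk_add i j a m hb).1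
    exact ⟨w, by rw [hw, abs_sub_comm, abs_of_nonneg (hw ▸ hd.walkLength_nonneg w)]⟩
  · obtain ⟨w, hw⟩ := (hd.exists_walk_add i j b m ha).2
    exact ⟨w, by rw [hw, abs_of_nonneg (hw ▸ hd.walkLength_nonneg w)]⟩

theorem graphDist_le {i j a b : Fin n} (w : (graph i j).Walk a b) :
    graphDist (graph i j) d a b ≤ walkLength d w :=
  ciInf_le ⟨0, by rintro _ ⟨w, rfl⟩; exact hd.walkLength_nonneg w⟩ w

theorem exists_walk_through (i j a b : Fin n) :
    ∃ w : (graph i j).Walk a b,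
      walkLength d w ≤ |pathPos d a - pathPos d i| + d i j + |pathPos d j - pathPos d b| := by
  obtain ⟨w, hw⟩ := hd.exists_walk i j a i
  obtain ⟨w', hw'⟩ := hd.exists_walk i j j b
  -- For `i = j` there is no edge to walk along, but its length is 0.
  rcases eq_or_ne i j with rfl | hij
  · refine ⟨w.append w', ?_⟩
    simp only [walkLength, SimpleGraph.Walk.darts_append, List.map_append,
      List.sum_append] at hw hw' ⊢
    rw [hw, hw', hd.self]
    linarith
  · refine ⟨w.append (.cons (graph_adj.2 (Or.inr ⟨Or.inl ⟨rfl, rfl⟩, hij⟩)) w'), ?_⟩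
    simp only [walkLength, SimpleGraph.Walk.darts_append, SimpleGraph.Walk.darts_cons,
      List.map_append, List.sum_append, List.map_cons, List.sum_cons] at hw hw' ⊢
    rw [hw, hw']
    linarith

theorem graphDist_eq (i j a b : Fin n) : graphDist (graph i j) d a b =
    lineDist (pathPos d i) (pathPos d j) (d i j) (pathPos d a) (pathPos d b) := by
  apply le_antisymm
  · refine le_min ?_ (le_min ?_ ?_)
    · obtain ⟨w, hw⟩ := hd.exists_walk i j a b
      exact hw ▸ hd.graphDist_le w
    · obtain ⟨w, hw⟩ := hd.exists_walk_through i j a b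
      exact (hd.graphDist_le w).trans hw
    · rw [graph_comm]
      obtain ⟨w, hw⟩ := hd.exists_walk_through j i a b
      rw [hd.symm j i] at hw
      exact (hd.graphDist_le w).trans hw
  · obtain ⟨w, -⟩ := hd.exists_walk i j a b
    have : Nonempty ((graph i j).Walk a b) := ⟨w⟩
    exact le_ciInf hd.lineDist_le_walkLength

end IsDist

end AugPath

/-! ### Points of the metric graph as positions on the line or on the shortcut -/

namespace AugPath

theorem abs_sub_eq_min {u v z y : ℝ} (hu : u ≤ z) (hv : z ≤ v) (hy : y ≤ u ∨ v ≤ y) :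
    |z - y| = min (z - u + |u - y|) (v - z + |v - y|) := by
  rcases hy with hy | hy
  · rw [abs_of_nonneg (by linarith), abs_of_nonneg (by linarith), abs_of_nonneg (by linarith),
      min_eq_left (by linarith)]
    ring
  · rw [abs_of_nonpos (by linarith), abs_of_nonpos (by linarith), abs_of_nonpos (by linarith),
      min_eq_right (by linarith)]
    ring

/-- A path from a point of an edge of the path leaves this edge through one of its ends. -/
theorem min_lineDist_eq {p q e u v z y : ℝ} (hu : u ≤ z) (hv : z ≤ v) (hp : p ≤ u ∨ v ≤ p)
    (hq : q ≤ u ∨ v ≤ q) (hy : y ≤ u ∨ v ≤ y) :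
    min (z - u + lineDist p q e u y) (v - z + lineDist p q e v y) = lineDist p q e z y := by
  simp only [lineDist]
  rw [abs_sub_eq_min hu hv hp, abs_sub_eq_min hu hv hq, abs_sub_eq_min hu hv hy]
  simp only [← min_add_add_left]
  rw [min_min_min_comm, min_min_min_comm (z - u + (_ + e + _))]
  simp only [← min_add_add_right, add_assoc]

/-- After leaving the shortcut through one end, crossing it back to the other end costs at least as
much as leaving through that end directly. -/
theorem min_lineDist_eq_shortcutDist {p q e t y : ℝ} (ht : 0 ≤ t) (ht' : t ≤ e) :
    min (t + lineDist p q e p y) (e - t + lineDist p q e q y) = shortcutDist p q e t y := by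
  have h1 := abs_nonneg (p - q)
  have h2 := abs_sub_comm p q
  simp only [lineDist, shortcutDist, sub_self, abs_zero, zero_add]
  apply le_antisymm
  · exact min_le_min (by linarith [min_le_left |p - y| (min (e + |q - y|) (|p - q| + e + |p - y|))])
      (by linarith [min_le_left |q - y| (min (|q - p| + e + |q - y|) (e + |p - y|))])
  · simp only [← min_add_add_left]
    refine le_min (le_min (min_le_left _ _) (le_min ?_ ?_)) (le_min (min_le_right _ _) (le_min ?_ ?_))
    · exact min_le_of_right_le (by linarith)
    · exact min_le_of_left_le (by linarith)
    · exact min_le_of_right_le (by linarith)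
    · exact min_le_of_left_le (by linarith)

variable {n : ℕ} {d : Fin n → Fin n → ℝ}

theorem le_ecc {i j : Fin n} (q : Point (graph i j) d) (l : Fin n) : pointDist q l ≤ ecc q :=
  le_ciSup (Set.finite_range _).bddAbove l

namespace IsDist

variable (hd : IsDist d)
include hd

theorem pathPos_mono {k l : ℕ} (hkl : k ≤ l) (hl : l < n) : pathPos d k ≤ pathPos d l := by
  rcases hkl.eq_or_lt with rfl | hlt
  · exact le_rfl
  · exact (hd.pathPos_lt hlt hl).le

theorem pathPos_outside {k l : ℕ} (hk : k + 1 < n) (hl : l < n) :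
    pathPos d l ≤ pathPos d k ∨ pathPos d (k + 1) ≤ pathPos d l := by
  rcases le_or_gt l k with h | h
  · exact Or.inl (hd.pathPos_mono h (by omega))
  · exact Or.inr (hd.pathPos_mono h hl)

theorem pointDist_vertex {i j : Fin n} (q : Point (graph i j) d) (h : q.a = q.b) (l : Fin n) :
    pointDist q l =
      lineDist (pathPos d i) (pathPos d j) (d i j) (pathPos d q.a) (pathPos d l) := by
  obtain ⟨a, b, t, hg, h0, h1⟩ := q
  obtain rfl : a = b := h
  rw [hd.self] at h1
  obtain rfl := le_antisymm h1 h0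
  simp [pointDist, hd.self, hd.graphDist_eq]

theorem pointDist_pathEdge {i j : Fin n} (q : Point (graph i j) d) (h : (q.a : ℕ) + 1 = q.b)
    (l : Fin n) : pointDist q l =
      lineDist (pathPos d i) (pathPos d j) (d i j) (pathPos d q.a + q.t) (pathPos d l) := by
  obtain ⟨⟨a, ha⟩, ⟨b, hb⟩, t, hg, h0, h1⟩ := q
  obtain rfl : a + 1 = b := h
  have hlen : d ⟨a, ha⟩ ⟨a + 1, hb⟩ = pathPos d (a + 1) - pathPos d a := by
    rw [pathPos_succ, pathEdge_of_lt hb, add_sub_cancel_left]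
  have hlen' := hlen
  rw [pathPos_succ] at hlen'
  rw [hlen] at h1
  rw [← min_lineDist_eq (u := pathPos d a) (v := pathPos d (a + 1)) (by simpa using h0)
    (by simp only; linarith) (hd.pathPos_outside hb i.2) (hd.pathPos_outside hb j.2)
    (hd.pathPos_outside hb l.2)]
  simp only [pointDist, hd.graphDist_eq, hlen]
  congr 2 <;> ring

/-- A `Point` may name the ends of its edge in either order; the lower bound has to cover both. -/
theorem pointDist_pathEdge_symm {i j : Fin n} (q : Point (graph i j) d) (h : (q.b : ℕ) + 1 = q.a)
    (l : Fin n) : pointDist q l =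
      lineDist (pathPos d i) (pathPos d j) (d i j) (pathPos d q.a - q.t) (pathPos d l) := by
  obtain ⟨a, b, t, hg, h0, h1⟩ := q
  have hlen := hd.eq_of_succ (Or.inr h)
  have hlt := hd.pathPos_lt (k := b) (l := a) (by simp only at h; omega) a.2
  simp only at hlen
  rw [abs_of_nonneg (by linarith)] at hlen
  have key := hd.pointDist_pathEdge (i := i) (j := j)
    ⟨b, a, d a b - t, hg.imp Eq.symm SimpleGraph.Adj.symm, by linarith,
      by rw [hd.symm b a]; linarith⟩ h l
  simp only at key ⊢
  rw [show pathPos d a - t = pathPos d b + (d a b - t) by rw [hlen]; ring, ← key]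
  simp only [pointDist, hd.symm b a]
  rw [min_comm, sub_sub_cancel]

theorem pointDist_shortcut {i j : Fin n} (q : Point (graph i j) d) (ha : q.a = i) (hb : q.b = j)
    (l : Fin n) : pointDist q l =
      shortcutDist (pathPos d i) (pathPos d j) (d i j) q.t (pathPos d l) := by
  obtain ⟨a, b, t, hg, h0, h1⟩ := q
  obtain rfl : a = i := ha
  obtain rfl : b = j := hb
  rw [← min_lineDist_eq_shortcutDist h0 h1]
  simp only [pointDist, hd.graphDist_eq]

theorem pointDist_shortcut_symm {i j : Fin n} (q : Point (graph i j) d) (ha : q.a = j)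
    (hb : q.b = i) (l : Fin n) : pointDist q l =
      shortcutDist (pathPos d i) (pathPos d j) (d i j) (d i j - q.t) (pathPos d l) := by
  obtain ⟨a, b, t, hg, h0, h1⟩ := q
  obtain rfl : a = j := ha
  obtain rfl : b = i := hb
  simp only at h1 ⊢
  rw [hd.symm] at h1
  rw [← min_lineDist_eq_shortcutDist (by linarith) (by linarith)]
  simp only [pointDist, hd.graphDist_eq, hd.symm a b, sub_sub_cancel]
  rw [min_comm]

/-- A lower bound of the eccentricities of the points of the line and of the shortcut. -/
theorem le_ecc_of_isLowerBound {i j : Fin n} {r : ℝ}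
    (hr : IsLowerBound (pathPos d) n i j (d i j) r) (q : Point (graph i j) d) : r ≤ ecc q := by
  have hline : ∀ z, 0 ≤ z → z ≤ pathPos d (n - 1) → (∀ l : Fin n, pointDist q l =
      lineDist (pathPos d i) (pathPos d j) (d i j) z (pathPos d l)) → r ≤ ecc q := by
    intro z h0 h1 hq
    obtain ⟨l, hl, hrl⟩ := hr.1 z h0 h1
    exact (hq ⟨l, hl⟩ ▸ hrl).trans (le_ecc q _)
  have hcut : ∀ t, 0 ≤ t → t ≤ d i j → (∀ l : Fin n, pointDist q l =
      shortcutDist (pathPos d i) (pathPos d j) (d i j) t (pathPos d l)) → r ≤ ecc q := by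
    intro z h0 h1 hq
    obtain ⟨l, hl, hrl⟩ := hr.2 z h0 h1
    exact (hq ⟨l, hl⟩ ▸ hrl).trans (le_ecc q _)
  have hbot : ∀ a : Fin n, 0 ≤ pathPos d a := fun a =>
    pathPos_zero (d := d) ▸ hd.pathPos_mono (Nat.zero_le _) a.2
  have htop : ∀ a : Fin n, pathPos d a ≤ pathPos d (n - 1) := fun a =>
    hd.pathPos_mono (Nat.le_sub_one_of_lt a.2) (Nat.sub_one_lt_of_lt a.2)
  have h0 := q.nonneg
  have h1 := q.le_length
  rcases q.on_graph with h | h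
  · exact hline _ (hbot _) (htop _) (hd.pointDist_vertex q h)
  rw [graph_adj] at h
  rcases h with (h | h) | ⟨⟨ha, hb⟩ | ⟨ha, hb⟩, -⟩
  · have hlen := hd.eq_of_succ (Or.inl h)
    rw [abs_of_nonpos (by linarith [hd.pathPos_lt (show (q.a : ℕ) < q.b by omega) q.b.2])] at hlen
    exact hline _ (by linarith [hbot q.a]) (by linarith [htop q.b]) (hd.pointDist_pathEdge q h)
  · have hlen := hd.eq_of_succ (Or.inr h)
    rw [abs_of_nonneg (by linarith [hd.pathPos_lt (show (q.b : ℕ) < q.a by omega) q.a.2])] at hlen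
    exact hline _ (by linarith [hbot q.b]) (by linarith [htop q.a]) (hd.pointDist_pathEdge_symm q h)
  · exact hcut _ h0 (by rwa [ha, hb] at h1) (hd.pointDist_shortcut q ha hb)
  · rw [ha, hb, hd.symm] at h1
    exact hcut _ (by linarith) (by linarith) (hd.pointDist_shortcut_symm q ha hb)

/-- The form in which optimality is proved: a lower bound for all points that one point attains. -/
theorem isCenter_of_isLowerBound {i j : Fin n} {r : ℝ}
    (hr : IsLowerBound (pathPos d) n i j (d i j) r) (c : Point (graph i j) d)
    (hc : ∀ l, pointDist c l ≤ r) : IsCenter c ∧ IsRadius (graph i j) d r := by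
  have : Nonempty (Fin n) := ⟨i⟩
  have hcr : ecc c ≤ r := ciSup_le hc
  have hcen : IsCenter c := fun q => hcr.trans (hd.le_ecc_of_isLowerBound hr q)
  exact ⟨hcen, c, hcen, hcr.antisymm (hd.le_ecc_of_isLowerBound hr c)⟩

/-- The point with position `z` on the path. -/
theorem exists_center_on_path {i j : Fin n} {r z : ℝ} {k b : ℕ}
    (hr : IsLowerBound (pathPos d) n i j (d i j) r) (hz : z ≤ pathPos d (n - 1))
    (hc : ∀ l < n, lineDist (pathPos d i) (pathPos d j) (d i j) z (pathPos d l) ≤ r)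
    (hk : IsLast (pathPos d) n z k) (hb : b = if k + 1 < n then k + 1 else k) :
    ∃ c : Point (graph i j) d, k = c.a ∧ b = c.b ∧ z - pathPos d k = c.t ∧
      IsCenter c ∧ IsRadius (graph i j) d r := by
  have h0 := hk.le
  split_ifs at hb with h
  · subst hb
    have h1 := hk.next h
    rw [pathPos_succ, pathEdge_of_lt h] at h1
    refine ⟨⟨⟨k, hk.lt⟩, ⟨k + 1, h⟩, z - pathPos d k, Or.inr (graph_adj.2 (Or.inl (Or.inl rfl))),
      by linarith, by linarith⟩, rfl, rfl, rfl, hd.isCenter_of_isLowerBound hr _ fun l => ?_⟩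
    rw [hd.pointDist_pathEdge _ rfl]
    simpa using hc l l.2
  -- The position is that of the last vertex, which starts no edge, so the center is shown as a
  -- vertex with `t = 0`.
  · subst hb
    obtain rfl : b = n - 1 := by have := hk.lt; omega
    obtain rfl := le_antisymm hz h0
    refine ⟨⟨⟨n - 1, hk.lt⟩, ⟨n - 1, hk.lt⟩, _, Or.inl rfl, by simp, by simp [hd.self]⟩, rfl, rfl,
      rfl, hd.isCenter_of_isLowerBound hr _ fun l => ?_⟩
    rw [hd.pointDist_vertex _ rfl]
    exact hc l l.2

/-- The point of the shortcut at distance `t` from its first end. -/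
theorem exists_center_on_shortcut {i j : Fin n} {r t : ℝ}
    (hr : IsLowerBound (pathPos d) n i j (d i j) r) (ht : 0 ≤ t) (ht' : t ≤ d i j)
    (hc : ∀ l < n, shortcutDist (pathPos d i) (pathPos d j) (d i j) t (pathPos d l) ≤ r) :
    ∃ c : Point (graph i j) d, i = c.a ∧ j = c.b ∧ t = c.t ∧
      IsCenter c ∧ IsRadius (graph i j) d r := by
  refine ⟨⟨i, j, t, ?_, ht, ht'⟩, rfl, rfl, rfl, hd.isCenter_of_isLowerBound hr _ fun l => ?_⟩
  · rw [graph_adj]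
    tauto
  · rw [hd.pointDist_shortcut _ rfl rfl]
    exact hc l l.2

end IsDist

theorem isDist_of_dist {X : Type*} [MetricSpace X] {v : Fin n → X} (hv : Function.Injective v)
    (hd : ∀ a b, d a b = dist (v a) (v b)) : IsDist d where
  self a := by rw [hd, dist_self]
  pos a b h := by rw [hd]; exact dist_pos.2 (hv.ne h)
  symm a b := by rw [hd, hd, dist_comm]
  triangle a b c := by rw [hd, hd, hd]; exact dist_triangle _ _ _

end AugPath

/-! ## Data structure and searches -/

namespace RealRAM

open AugPath

/-- The state after preprocessing, as far as queries use it: the positions `x k` of the vertices,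
and a binary tree over the edges of the path (the edge that starts at the vertex `k` is the leaf
`n + k`) with the length and the first end of a longest edge below each node. -/
structure Ready (x : ℕ → ℝ) (n : ℕ) (s : State) : Prop where
  two : s.ireg 2 = n
  three : s.ireg 3 = 0
  four : s.ireg 4 = 1
  six : s.ireg 6 = n - 1
  pos : ∀ k < n, s.rarr 0 k = x k
  leaf : ∀ k, k + 1 < n → s.rarr 1 (n + k) = x (k + 1) - x k ∧ s.rarr 2 (n + k) = x k
  node : ∀ p, 1 ≤ p → p < n → s.rarr 1 (2 * p) ≤ s.rarr 1 p ∧ s.rarr 1 (2 * p + 1) ≤ s.rarr 1 p ∧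
    ((s.rarr 1 p = s.rarr 1 (2 * p) ∧ s.rarr 2 p = s.rarr 2 (2 * p)) ∨
      (s.rarr 1 p = s.rarr 1 (2 * p + 1) ∧ s.rarr 2 p = s.rarr 2 (2 * p + 1)))

/-- The registers used by a binary search aside, `s'` agrees with `s`. -/
structure Keeps (s s' : State) : Prop where
  ireg : ∀ k < 10, s'.ireg k = s.ireg k
  rreg : ∀ k ≠ 11, s'.rreg k = s.rreg k
  rarr : s'.rarr = s.rarr

theorem Ready.of_eq {x : ℕ → ℝ} {n : ℕ} {s s' : State} (h : Ready x n s)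
    (h2 : s'.ireg 2 = s.ireg 2) (h3 : s'.ireg 3 = s.ireg 3) (h4 : s'.ireg 4 = s.ireg 4)
    (h6 : s'.ireg 6 = s.ireg 6) (hr : s'.rarr = s.rarr) : Ready x n s' where
  two := h2.trans h.two
  three := h3.trans h.three
  four := h4.trans h.four
  six := h6.trans h.six
  pos := hr ▸ h.pos
  leaf := hr ▸ h.leaf
  node := hr ▸ h.node

theorem Ready.keeps {x : ℕ → ℝ} {n : ℕ} {s s' : State} (h : Ready x n s) (hk : Keeps s s') :
    Ready x n s' :=
  h.of_eq (hk.ireg _ (by norm_num)) (hk.ireg _ (by norm_num)) (hk.ireg _ (by norm_num))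
    (hk.ireg _ (by norm_num)) hk.rarr

/-- Binary search: `I[10] :=` the last vertex whose position is at most `R[10]`. -/
def locate : Prog :=
  .seq (code [.iadd 11 4 3, .iadd 10 6 3])
    (.loop (.ile 11 10)
      (.seq (code [.iadd 12 11 10, .ihalf 12 12, .rload 11 0 12])
        (.branch (.rle 11 10) (code [.iadd 11 12 4]) (code [.isub 10 12 4]))))

variable {n : ℕ} {d : Fin n → Fin n → ℝ} {M : ℕ} {x : ℕ → ℝ}

/-- The half-open search keeps `x (lo - 1) ≤ c` and `c < x k` for all `k > hi`, where `lo` and `hi`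
are `I[11]` and `I[10]`. Starting at `lo = 1` is legitimate by `hc`, and it keeps the truncated
subtractions exact. -/
theorem run_locate {s : State} {m : ℕ} (hs : Ready x n s) (hn : 1 ≤ n) (hM : 2 * n ≤ M)
    (hm : n < 2 ^ m) (hx : ∀ k l, k < l → l < n → x k < x l) (hc : x 0 ≤ s.rreg 10) :
    Run d M locate s (8 * m + 4)
      (fun s' => Keeps s s' ∧ IsLast x n (s.rreg 10) (s'.ireg 10)) := by
  have h3 := hs.three
  have h4 := hs.four
  have h6 := hs.six
  let I : ℕ → State → Prop := fun m s' => Keeps s s' ∧ 1 ≤ s'.ireg 11 ∧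
    s'.ireg 11 ≤ s'.ireg 10 + 1 ∧ s'.ireg 10 < n ∧ x (s'.ireg 11 - 1) ≤ s.rreg 10 ∧
    (∀ k, s'.ireg 10 < k → k < n → s.rreg 10 < x k) ∧ s'.ireg 10 + 1 - s'.ireg 11 < 2 ^ m
  have hloop : ∀ s', I m s' → Run d M (.loop (.ile 11 10)
      (.seq (code [.iadd 12 11 10, .ihalf 12 12, .rload 11 0 12])
        (.branch (.rle 11 10) (code [.iadd 11 12 4]) (code [.isub 10 12 4])))) s'
      (8 * m + 1)
      (fun s' => Keeps s s' ∧ IsLast x n (s.rreg 10) (s'.ireg 10)) := by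
    intro s' hI
    -- The number of remaining candidates is below `2 ^ m`, and every round at least halves it. A
    -- round costs 7 steps and the test 1.
    refine (Run.loop (T := 4 + (max 2 2 + 1)) (I := I) ?_ ?_ hI).mono (by norm_num) ?_
    · rintro s' ⟨-, -, -, -, -, -, h⟩
      simp only [Test.holds, pow_zero] at h ⊢
      omega
    · rintro m s' ⟨hk, h1, h2, h3', h5, h7, h8⟩ hb
      have hr := hs.keeps hk
      have e4 := hr.four
      simp only [Test.holds] at hb
      have hmid : (s'.ireg 11 + s'.ireg 10) / 2 < n := by omega
      have hload := hr.pos _ hmid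
      have hp : 2 ^ (m + 1) = 2 * 2 ^ m := by ring
      have hkk : ∀ k ≠ 11, s'.rreg k = s.rreg k := hk.rreg
      refine Run.seq (Run.code ?_)
      simp only [post_iadd, post_ihalf, post_rload, post_nil, State.putI_ireg, State.putI_rarr]
      refine ⟨by omega, by simp; omega, ?_⟩
      refine Run.branch (fun hb' => Run.code ?_) (fun hb' => Run.code ?_) <;>
        simp [Test.holds, hload, hkk, e4] at hb' ⊢
      · refine ⟨by omega, ⟨?_, ?_, ?_⟩, ?_, ?_, ?_, ?_, ?_, ?_⟩
        · intro k hk10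
          simp [show k ≠ 11 by omega, show k ≠ 12 by omega, hk.ireg k hk10]
        · intro k hk11
          simp [hk11, hkk k hk11]
        · simp [hk.rarr]
        · simp
        · simp; omega
        · simpa using h3'
        · simpa using hb'
        · simpa using h7
        · simp; omega
      · refine ⟨by omega, ⟨?_, ?_, ?_⟩, ?_, ?_, ?_, ?_, ?_, ?_⟩
        · intro k hk10
          simp [show k ≠ 10 by omega, show k ≠ 12 by omega, hk.ireg k hk10]
        · intro k hk11
          simp [hk11, hkk k hk11]
        · simp [hk.rarr]
        · simpa using h1
        · simp; omega
        · simp; omega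
        · simpa using h5
        · simp only [State.putI_ireg]
          simp
          intro k hk1 hk2
          rcases (show (s'.ireg 11 + s'.ireg 10) / 2 ≤ k by omega).eq_or_lt with rfl | hlt
          · exact hb'
          · exact hb'.trans (hx _ _ hlt hk2)
        · simp; omega
    · rintro s' ⟨hb, k, hk, h1, h2, h3', h5, h7, -⟩
      simp only [Test.holds] at hb
      refine ⟨hk, h3', ?_, fun h => h7 _ (Nat.lt_succ_self _) h⟩
      rwa [show s'.ireg 10 = s'.ireg 11 - 1 by omega]
  refine (Run.seq (Run.code ?_)).mono (by simp only [List.length_cons, List.length_nil]; omega :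
      _ + (8 * m + 1) ≤ _)
    fun _ h => h
  simp only [post_iadd, post_nil]
  simp [h3, h4, h6]
  refine ⟨by omega, by omega, hloop _ ⟨⟨?_, ?_, ?_⟩, ?_, ?_, ?_, ?_, ?_, ?_⟩⟩
  · intro k hk10
    simp [show k ≠ 11 by omega, show k ≠ 10 by omega]
  · simp
  · simp
  · simp
  · simp
  · simp; omega
  · simpa using hc
  · simp; omega
  · simp; omega

end RealRAM

/-! ## The query program -/

namespace RealRAM

open AugPath

variable {n : ℕ} {d : Fin n → Fin n → ℝ} {M : ℕ} {x : ℕ → ℝ} {i j m : ℕ} {e : ℝ} {s : State}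

theorem State.setR_setR (s : State) (a : ℕ) (r r' : ℝ) : (s.setR a r).setR a r' = s.setR a r' := by
  simp [State.setR]

theorem State.setR_self (s : State) (a : ℕ) : s.setR a (s.rreg a) = s := by
  simp [State.setR]

/-- `R[a] := max R[a] R[b]` -/
def maxInto (a b : ℕ) : Prog :=
  .branch (.rle a b) (code [.radd a b b, .rhalf a a]) .skip

/-- A real is copied by doubling and halving; `State.setR_setR` hides the intermediate value. -/
theorem run_maxInto {a b : ℕ} {Q : State → Prop}
    (h : Q (s.setR a (max (s.rreg a) (s.rreg b)))) : Run d M (maxInto a b) s 4 Q := by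
  refine Run.branch (T := 3) (U := 1) (fun hb => Run.code ?_) (fun hb => Run.skip ?_)
  · simp only [Test.holds] at hb
    rw [max_eq_right hb] at h
    simpa [State.setR_setR] using h
  · simp only [Test.holds, not_le] at hb
    rwa [max_eq_left hb.le, State.setR_self] at h

/-- The machine is ready and has loaded the data of the query `i ≤ j`. -/
structure Loaded (x : ℕ → ℝ) (n i j : ℕ) (e : ℝ) (s : State) : Prop where
  ready : Ready x n s
  i0 : s.ireg 0 = i
  i1 : s.ireg 1 = j
  r2 : s.rreg 2 = x i
  r3 : s.rreg 3 = x j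
  r4 : s.rreg 4 = x (n - 1)
  r5 : s.rreg 5 = e
  r6 : s.rreg 6 = x (n - 1) - x j
  r7 : s.rreg 7 = x j - x i

theorem Loaded.of_eq {s' : State} (h : Loaded x n i j e s)
    (hi : ∀ k < 5, s'.ireg k = s.ireg k) (hi' : s'.ireg 6 = s.ireg 6)
    (hr : ∀ k, 2 ≤ k → k < 8 → s'.rreg k = s.rreg k) (ha : s'.rarr = s.rarr) :
    Loaded x n i j e s' where
  ready := h.ready.of_eq (hi _ (by norm_num)) (hi _ (by norm_num)) (hi _ (by norm_num)) hi' ha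
  i0 := (hi _ (by norm_num)).trans h.i0
  i1 := (hi _ (by norm_num)).trans h.i1
  r2 := (hr _ (by norm_num) (by norm_num)).trans h.r2
  r3 := (hr _ (by norm_num) (by norm_num)).trans h.r3
  r4 := (hr _ (by norm_num) (by norm_num)).trans h.r4
  r5 := (hr _ (by norm_num) (by norm_num)).trans h.r5
  r6 := (hr _ (by norm_num) (by norm_num)).trans h.r6
  r7 := (hr _ (by norm_num) (by norm_num)).trans h.r7

theorem Loaded.keeps {s' : State} (h : Loaded x n i j e s) (hk : Keeps s s') :
    Loaded x n i j e s' :=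
  h.of_eq (fun k hk' => hk.ireg k (by omega)) (hk.ireg _ (by norm_num))
    (fun k _ hk' => hk.rreg k (by omega)) hk.rarr

/-- Order the query `I[0], I[1]` and load its data. -/
def loadQuery : Prog :=
  .seq (.branch (.ile 0 1) .skip (code [.iadd 5 0 3, .iadd 0 1 3, .iadd 1 5 3]))
    (code [.rload 2 0 0, .rload 3 0 1, .rload 4 0 6, .dist 5 0 1, .rsub 6 4 3, .rsub 7 3 2])

theorem run_loadQuery {i j : Fin n} (hs : Ready x n s) (hM : 2 * n ≤ M)
    (hij : (s.ireg 0 = i ∧ s.ireg 1 = j) ∨ (s.ireg 0 = j ∧ s.ireg 1 = i)) (hle : i ≤ j) :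
    Run d M loadQuery s 20 (Loaded x n i j (d i j)) := by
  have hi := i.2
  have hj := j.2
  have hle' : (i : ℕ) ≤ j := hle
  have hload : ∀ s, Ready x n s → s.ireg 0 = i → s.ireg 1 = j → Run d M
      (code [.rload 2 0 0, .rload 3 0 1, .rload 4 0 6, .dist 5 0 1, .rsub 6 4 3, .rsub 7 3 2])
      s 7 (Loaded x n i j (d i j)) := by
    intro s hs h0 h1
    have h6 := hs.six
    have e0 := hs.pos _ hi
    have e1 := hs.pos _ hj
    have e2 := hs.pos (n - 1) (by omega)
    refine Run.code ?_
    simp [h0, h1, h6, e0, e1, e2]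
    exact ⟨hs.of_eq (by simp) (by simp) (by simp) (by simp) (by simp), by simp [h0], by simp [h1],
      by simp, by simp, by simp, by simp, by simp, by simp⟩
  refine ((Run.branch (T := 1) (U := 4) (fun hb => Run.skip ?_) (fun hb => Run.code ?_)).seq
    (U := 7)).mono (by norm_num) fun _ h => h
  · simp only [Test.holds] at hb
    rcases hij with ⟨h0, h1⟩ | ⟨h0, h1⟩
    · exact hload s hs h0 h1
    · have : (i : ℕ) = j := by omega
      exact hload s hs (by omega) (by omega)
  · simp only [Test.holds] at hb
    rcases hij with ⟨h0, h1⟩ | ⟨h0, h1⟩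
    · omega
    · have h3 := hs.three
      simp [h0, h1, h3]
      exact ⟨by omega, by omega, by omega,
        hload _ (hs.of_eq (by simp) (by simp) (by simp) (by simp) (by simp)) (by simp) (by simp)⟩

/-- `R[8] :=` the largest distance from `i` to the vertices that do not precede it. -/
def reachRight : Prog :=
  .seq (code [.radd 10 2 3, .radd 10 10 5, .rhalf 10 10]) <|
  .seq locate <|
  .seq (code [.rload 12 0 10, .rsub 8 12 2, .iadd 5 10 4]) <|
  .seq (.branch (.ile 5 1)
    (.seq (code [.rload 12 0 5, .radd 13 5 3, .rsub 12 13 12]) (maxInto 8 12)) .skip) <|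
  .seq (code [.radd 12 5 6]) (maxInto 8 12)

/-- `R[9] :=` the largest distance from `j` to the vertices that do not follow it. -/
def reachLeft : Prog :=
  .seq (code [.radd 10 2 3, .rsub 10 10 5, .rhalf 10 10]) <|
  .seq locate <|
  .seq (code [.rload 12 0 10, .radd 9 5 12, .rsub 9 9 2, .iadd 5 10 4]) <|
  .seq (.branch (.ile 5 1)
    (.seq (code [.rload 12 0 5, .rsub 12 3 12]) (maxInto 9 12)) .skip) <|
  .seq (code [.radd 12 5 2]) (maxInto 9 12)

theorem run_reachRight (h : Shortcut x n i j e) (hs : Loaded x n i j e s) (hM : 2 * n ≤ M)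
    (hm : n < 2 ^ m) : Run d M reachRight s (8 * m + 40)
      (fun s' => Loaded x n i j e s' ∧ IsReachRight x n i j e (s'.rreg 8)) := by
  have hn := h.lt
  have hi0 := h.nonneg_pos (h.le.trans_lt hn)
  have hij := h.mono h.le hn
  have he := h.nonneg
  let s₁ := ((s.setR 10 (x i + x j)).setR 10 (x i + x j + e)).setR 10 ((x i + x j + e) / 2)
  have hs₁ : Loaded x n i j e s₁ :=
    hs.of_eq (by simp [s₁]) (by simp [s₁])
      (fun k _ _ => by simp [s₁, show k ≠ 10 by omega]) (by simp [s₁])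
  refine (Run.seq (T := 4) (Run.code ?_)).mono (U := 8 * m + 40)
    -- The summands are the costs of the blocks of `reachRight` in order; `8 * m + 4` is `locate`.
    (by omega : 4 + ((8 * m + 4) + (4 + ((max (4 + 4) 1 + 1) + (2 + 4)))) ≤ _) fun _ h => h
  simp only [post_radd, post_rhalf, post_nil, State.setR_rreg, hs.r2, hs.r3, hs.r5]
  refine Run.andThen (s := s₁) (run_locate hs₁.ready (by omega) hM hm h.strict ?_) ?_
  · simp only [h.zero, s₁, State.setR_rreg]
    simp
    linarith
  rintro s' ⟨hk, hl⟩
  have hs' := hs₁.keeps hk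
  have h10 : s₁.rreg 10 = (x i + x j + e) / 2 := by simp [s₁]
  rw [h10] at hl
  have hR := h.isReachRight_of_isLast hl
  generalize hkk : s'.ireg 10 = k at hl hR
  have hkn := hl.lt
  have h4 := hs'.ready.four
  have hpk := hs'.ready.pos k hkn
  refine Run.seq (Run.code ?_)
  simp [hkk, hpk, h4, hs'.r2]
  refine ⟨by omega, ?_⟩
  refine Run.seq (U := 2 + 4) (Run.branch (T := 4 + 4) (fun hb => ?_) (fun hb => Run.skip ?_))
  · simp [Test.holds, hs'.i1] at hb
    have hpk' := hs'.ready.pos (k + 1) (by omega)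
    refine Run.seq (Run.code ?_)
    simp [hs'.r3, hs'.r5, hpk']
    refine run_maxInto (Run.seq (T := 2) (U := 4) (Run.code ?_))
    simp [hs'.r5, hs'.r6]
    refine run_maxInto ⟨hs'.of_eq ?_ ?_ ?_ ?_, ?_⟩
    · intro k hk; simp [show k ≠ 5 by omega]
    · simp
    · intro k h2 hk; simp [show k ≠ 8 by omega, show k ≠ 12 by omega, show k ≠ 13 by omega]
    · simp
    · rw [if_pos (by omega)] at hR
      simpa [max_comm] using hR
  · simp [Test.holds, hs'.i1] at hb
    refine Run.seq (T := 2) (U := 4) (Run.code ?_)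
    simp [hs'.r5, hs'.r6]
    refine run_maxInto ⟨hs'.of_eq ?_ ?_ ?_ ?_, ?_⟩
    · intro k hk; simp [show k ≠ 5 by omega]
    · simp
    · intro k h2 hk; simp [show k ≠ 8 by omega, show k ≠ 12 by omega]
    · simp
    · rw [if_neg (by omega)] at hR
      simpa [max_comm] using hR

theorem run_reachLeft (h : Shortcut x n i j e) (hs : Loaded x n i j e s) (hM : 2 * n ≤ M)
    (hm : n < 2 ^ m) : Run d M reachLeft s (8 * m + 40)
      (fun s' => Loaded x n i j e s' ∧ s'.rreg 8 = s.rreg 8 ∧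
        IsReachLeft x i j e (s'.rreg 9)) := by
  have hn := h.lt
  have hi0 := h.nonneg_pos (h.le.trans_lt hn)
  have hij := h.mono h.le hn
  have hsh := h.short
  let s₁ := ((s.setR 10 (x i + x j)).setR 10 (x i + x j - e)).setR 10 ((x i + x j - e) / 2)
  have hs₁ : Loaded x n i j e s₁ :=
    hs.of_eq (by simp [s₁]) (by simp [s₁])
      (fun k _ _ => by simp [s₁, show k ≠ 10 by omega]) (by simp [s₁])
  refine (Run.seq (T := 4) (Run.code ?_)).mono (U := 8 * m + 40)
    (by omega : 4 + ((8 * m + 4) + (5 + ((max (3 + 4) 1 + 1) + (2 + 4)))) ≤ _) fun _ h => h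
  simp only [post_radd, post_rsub, post_rhalf, post_nil, State.setR_rreg, hs.r2, hs.r3, hs.r5]
  refine Run.andThen (s := s₁) (run_locate hs₁.ready (by omega) hM hm h.strict ?_) ?_
  · simp only [h.zero, s₁, State.setR_rreg]
    simp
    linarith
  rintro s' ⟨hk, hl⟩
  have hs' := hs₁.keeps hk
  have h8 : s'.rreg 8 = s.rreg 8 := by
    rw [hk.rreg 8 (by norm_num)]
    simp [s₁]
  have h10 : s₁.rreg 10 = (x i + x j - e) / 2 := by simp [s₁]
  rw [h10] at hl
  have hR := h.isReachLeft_of_isLast hl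
  generalize hkk : s'.ireg 10 = k at hl hR
  have hkn := hl.lt
  have h4 := hs'.ready.four
  have hpk := hs'.ready.pos k hkn
  refine Run.seq (Run.code ?_)
  simp [hkk, hpk, h4, hs'.r2, hs'.r5]
  refine ⟨by omega, ?_⟩
  refine Run.seq (U := 2 + 4) (Run.branch (T := 3 + 4) (fun hb => ?_) (fun hb => Run.skip ?_))
  · simp [Test.holds, hs'.i1] at hb
    have hpk' := hs'.ready.pos (k + 1) (by omega)
    refine Run.seq (Run.code ?_)
    simp [hs'.r3, hpk']
    refine run_maxInto (Run.seq (T := 2) (U := 4) (Run.code ?_))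
    simp [hs'.r5, hs'.r2]
    refine run_maxInto ⟨hs'.of_eq ?_ ?_ ?_ ?_, ?_, ?_⟩
    · intro k hk; simp [show k ≠ 5 by omega]
    · simp
    · intro k h2 hk; simp [show k ≠ 9 by omega, show k ≠ 12 by omega]
    · simp
    · simp [h8]
    · rw [if_pos (by omega)] at hR
      simpa [max_comm] using hR
  · simp [Test.holds, hs'.i1] at hb
    refine Run.seq (T := 2) (U := 4) (Run.code ?_)
    simp [hs'.r5, hs'.r2]
    refine run_maxInto ⟨hs'.of_eq ?_ ?_ ?_ ?_, ?_, ?_⟩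
    · intro k hk; simp [show k ≠ 5 by omega]
    · simp
    · intro k h2 hk; simp [show k ≠ 9 by omega, show k ≠ 12 by omega]
    · simp
    · simp [h8]
    · rw [if_neg (by omega)] at hR
      simpa [max_comm] using hR

/-- Show the point of the path at the position `R[10]`. -/
def showPosition : Prog :=
  .seq locate <|
  .seq (code [.rload 12 0 10, .rsub 0 10 12, .iadd 0 10 3, .iadd 5 10 4]) <|
  .branch (.ile 5 6) (code [.iadd 1 5 3]) (code [.iadd 1 10 3])

/-- `s` shows the point of the path at the position `z`. -/
def ShowsPosition (x : ℕ → ℝ) (n : ℕ) (z : ℝ) (s : State) : Prop :=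
  ∃ k, IsLast x n z k ∧ s.ireg 0 = k ∧ s.ireg 1 = (if k + 1 < n then k + 1 else k) ∧
    s.rreg 0 = z - x k

theorem run_showPosition (h : Shortcut x n i j e) (hs : Ready x n s) (hM : 2 * n ≤ M)
    (hm : n < 2 ^ m) (hz : 0 ≤ s.rreg 10) : Run d M showPosition s (8 * m + 12)
      (fun s' => Ready x n s' ∧ ShowsPosition x n (s.rreg 10) s' ∧ s'.rreg 1 = s.rreg 1) := by
  have hn := h.lt
  refine (Run.andThen (T := 8 * m + 4) (U := 5 + (max 2 2 + 1))
    (run_locate hs (by omega) hM hm h.strict (h.zero ▸ hz)) ?_).mono (by omega) fun _ h => h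
  rintro s' ⟨hk, hl⟩
  have hs' := hs.keeps hk
  have h1 := hk.rreg 1 (by norm_num)
  have h10 := hk.rreg 10 (by norm_num)
  generalize hkk : s'.ireg 10 = k at hl
  have hkn := hl.lt
  have h3 := hs'.three
  have h4 := hs'.four
  have h6 := hs'.six
  have hpk := hs'.pos k hkn
  refine Run.seq (Run.code ?_)
  simp [hkk, hpk, h4, h3, h10]
  refine ⟨by omega, by omega, ?_⟩
  refine Run.branch (fun hb => Run.code ?_) (fun hb => Run.code ?_) <;>
    simp [Test.holds, h6] at hb <;> simp [h3, hkk]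
  · refine ⟨by omega, hs'.of_eq (by simp) (by simp) (by simp) (by simp) (by simp),
      ⟨k, hl, by simp, ?_, by simp⟩, h1⟩
    rw [if_pos (by omega)]
    simp
  · refine ⟨by omega, hs'.of_eq (by simp) (by simp) (by simp) (by simp) (by simp),
      ⟨k, hl, by simp, ?_, by simp⟩, h1⟩
    rw [if_neg (by omega)]
    simp

end RealRAM

/-! ## The widest gap on the path -/

namespace RealRAM

open AugPath

variable {n : ℕ} {d : Fin n → Fin n → ℝ} {M : ℕ} {x : ℕ → ℝ} {i j m : ℕ} {e : ℝ} {s : State}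

/-- Replace the gap with length `R[14]` and first end `R[15]` by the one with length `R[17]` and
first end `R[16]`, if this is not shorter. -/
def takeGap : Prog :=
  .branch (.rle 14 17) (code [.radd 14 17 17, .rhalf 14 14, .radd 15 16 16, .rhalf 15 15]) .skip

/-- Compare with the longest edge below the node `I[8]`. -/
def takeLow : Prog :=
  .seq (code [.rload 17 1 8, .rload 16 2 8]) (.seq takeGap (code [.iadd 8 8 4]))

/-- Compare with the longest edge below the node `I[9]`. -/
def takeHigh : Prog :=
  .seq (code [.rload 17 1 9, .rload 16 2 9]) (.seq takeGap (code [.isub 9 9 4]))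

/-- Treat the ends of the range `I[8], …, I[9]` of nodes that have no sibling in the range, and
replace the others by their parents. -/
def climb : Prog :=
  .seq (code [.ihalf 13 8, .iadd 14 13 13]) <|
  .seq (.branch (.ile 8 14) .skip takeLow) <|
  .seq (code [.ihalf 13 9, .iadd 14 13 13]) <|
  .seq (.branch (.ile 9 14) takeHigh .skip) <|
  code [.ihalf 8 8, .ihalf 9 9]

/-- The gaps that remain to be compared with the current gap are those of the edges below the nodes
`lo, …, hi`. -/
structure Scanning (x : ℕ → ℝ) (n i j : ℕ) (e A B : ℝ) (k₁ k₂ lo hi : ℕ) (s : State) : Prop where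
  loaded : Loaded x n i j e s
  i8 : s.ireg 8 = lo
  i9 : s.ireg 9 = hi
  pos : 1 ≤ lo
  top : hi < 2 * n
  gap : IsGap x i j A B (s.rreg 15) (s.rreg 14)
  first : x (k₁ + 1) - A ≤ s.rreg 14
  last : B - x k₂ ≤ s.rreg 14
  sound : ∀ p, lo ≤ p → p ≤ hi →
    ∃ k, k₁ < k ∧ k < k₂ ∧ s.rarr 1 p = x (k + 1) - x k ∧ s.rarr 2 p = x k
  complete : ∀ k, k₁ < k → k < k₂ → x (k + 1) - x k ≤ s.rreg 14 ∨
    ∃ p, lo ≤ p ∧ p ≤ hi ∧ x (k + 1) - x k ≤ s.rarr 1 p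

variable {A B : ℝ} {k₁ k₂ lo hi : ℕ}

theorem isGap_pathEdge (h : Shortcut x n i j e) (h₁ : IsLast x n A k₁)
    (h₂ : IsLast x n B k₂) {k : ℕ} (hk₁ : k₁ < k) (hk₂ : k < k₂) :
    IsGap x i j A B (x k) (x (k + 1) - x k) := by
  have hk₂n := h₂.lt
  refine ⟨by linarith [h.strict k (k + 1) (Nat.lt_succ_self k) (by omega)],
    (h.lt_of_isLast h₁ (by omega) hk₁).le, ?_, fun l hil hlj => ?_⟩
  · linarith [h.mono (show k + 1 ≤ k₂ from hk₂) hk₂n, h₂.le]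
  · have hn := h.lt
    rcases le_or_gt l k with hlk | hlk
    · exact Or.inl (h.mono hlk (by omega))
    · exact Or.inr (by linarith [h.mono (show k + 1 ≤ l from hlk) (by omega)])

/-- Callers need only that the new gap is one of the two candidates and at least as long as both, so
the outcome of the comparison is abstracted away. -/
theorem run_takeGap {Q : State → Prop}
    (h : ∀ w g, ((w = s.rreg 14 ∧ g = s.rreg 15) ∨ (w = s.rreg 17 ∧ g = s.rreg 16)) →
      s.rreg 14 ≤ w → s.rreg 17 ≤ w → Q ((s.setR 14 w).setR 15 g)) :
    Run d M takeGap s 6 Q := by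
  refine Run.branch (T := 5) (U := 1) (fun hb => Run.code ?_) (fun hb => Run.skip ?_)
  · simp only [Test.holds] at hb
    have := h _ _ (Or.inr ⟨rfl, rfl⟩) hb le_rfl
    simpa [State.setR_setR] using this
  · simp only [Test.holds, not_le] at hb
    have := h _ _ (Or.inl ⟨rfl, rfl⟩) le_rfl hb.le
    have h15 : s.rreg 15 = (s.setR 14 (s.rreg 14)).rreg 15 := by simp
    rwa [h15, State.setR_self, State.setR_self] at this

theorem run_takeLow (h : Shortcut x n i j e) (h₁ : IsLast x n A k₁)
    (h₂ : IsLast x n B k₂) (hM : 2 * n ≤ M) (hs : Scanning x n i j e A B k₁ k₂ lo hi s)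
    (hle : lo ≤ hi) : Run d M takeLow s 11 (Scanning x n i j e A B k₁ k₂ (lo + 1) hi) := by
  obtain ⟨hl, h8, h9, hpos, htop, hgap, hfirst, hlast, hsound, hcompl⟩ := hs
  have h4 := hl.ready.four
  obtain ⟨k, hk₁, hk₂, hw, hg⟩ := hsound lo le_rfl hle
  refine Run.seq (T := 3) (U := 6 + 2) (Run.code ?_)
  simp [h8, hw, hg]
  refine Run.seq (run_takeGap fun w g hwg hw1 hw2 => Run.code ?_)
  simp at hwg hw1 hw2
  simp [h8, h4]
  refine ⟨by omega, hl.of_eq ?_ ?_ ?_ ?_, ?_, ?_, by omega, htop, ?_, ?_, ?_, ?_, ?_⟩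
  · intro k hk; simp [show k ≠ 8 by omega]
  · simp
  · intro k h2 hk
    simp [show k ≠ 14 by omega, show k ≠ 15 by omega, show k ≠ 16 by omega, show k ≠ 17 by omega]
  · simp
  · simp
  · simpa using h9
  · simp
    rcases hwg with ⟨rfl, rfl⟩ | ⟨rfl, rfl⟩
    · exact hgap
    · exact isGap_pathEdge h h₁ h₂ hk₁ hk₂
  · simp; linarith
  · simp; linarith
  · intro p hp
    simpa using hsound p (by omega)
  · intro k' hk₁' hk₂'
    simp
    rcases hcompl k' hk₁' hk₂' with hc | ⟨p, hp1, hp2, hc⟩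
    · left; linarith
    · rcases hp1.eq_or_lt with rfl | hlt
      · left; linarith
      · exact Or.inr ⟨p, hlt, hp2, by linarith⟩

theorem run_takeHigh (h : Shortcut x n i j e) (h₁ : IsLast x n A k₁)
    (h₂ : IsLast x n B k₂) (hM : 2 * n ≤ M) (hs : Scanning x n i j e A B k₁ k₂ lo hi s)
    (hle : lo ≤ hi) : Run d M takeHigh s 11 (Scanning x n i j e A B k₁ k₂ lo (hi - 1)) := by
  obtain ⟨hl, h8, h9, hpos, htop, hgap, hfirst, hlast, hsound, hcompl⟩ := hs
  have h4 := hl.ready.four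
  obtain ⟨k, hk₁, hk₂, hw, hg⟩ := hsound hi hle le_rfl
  refine Run.seq (T := 3) (U := 6 + 2) (Run.code ?_)
  simp [h9, hw, hg]
  refine Run.seq (run_takeGap fun w g hwg hw1 hw2 => Run.code ?_)
  simp at hwg hw1 hw2
  simp [h9, h4]
  refine ⟨by omega, hl.of_eq ?_ ?_ ?_ ?_, ?_, ?_, hpos, by omega, ?_, ?_, ?_, ?_, ?_⟩
  · intro k hk; simp [show k ≠ 9 by omega]
  · simp
  · intro k h2 hk
    simp [show k ≠ 14 by omega, show k ≠ 15 by omega, show k ≠ 16 by omega, show k ≠ 17 by omega]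
  · simp
  · simpa using h8
  · simp
  · simp
    rcases hwg with ⟨rfl, rfl⟩ | ⟨rfl, rfl⟩
    · exact hgap
    · exact isGap_pathEdge h h₁ h₂ hk₁ hk₂
  · simp; linarith
  · simp; linarith
  · intro p hp hp'
    simpa using hsound p hp (by omega)
  · intro k' hk₁' hk₂'
    simp
    rcases hcompl k' hk₁' hk₂' with hc | ⟨p, hp1, hp2, hc⟩
    · left; linarith
    · rcases hp2.eq_or_lt with rfl | hlt
      · left; linarith
      · exact Or.inr ⟨p, hp1, by omega, by linarith⟩

theorem Scanning.scratch (hs : Scanning x n i j e A B k₁ k₂ lo hi s) (a b : ℕ) :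
    Scanning x n i j e A B k₁ k₂ lo hi ((s.putI 13 a).putI 14 b) := by
  obtain ⟨hl, h8, h9, hpos, htop, hgap, hfirst, hlast, hsound, hcompl⟩ := hs
  refine ⟨hl.of_eq ?_ ?_ ?_ ?_, ?_, ?_, hpos, htop, hgap, hfirst, hlast, hsound, hcompl⟩
  · intro k hk; simp [show k ≠ 13 by omega, show k ≠ 14 by omega]
  · simp
  · simp
  · simp
  · simpa using h8
  · simpa using h9

/-- Pass to the parents. -/
theorem Scanning.parents (hs : Scanning x n i j e A B k₁ k₂ lo hi s) (hlo : lo % 2 = 0)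
    (hhi : hi % 2 = 1) :
    Scanning x n i j e A B k₁ k₂ (lo / 2) (hi / 2) ((s.putI 8 (lo / 2)).putI 9 (hi / 2)) := by
  obtain ⟨hl, h8, h9, hpos, htop, hgap, hfirst, hlast, hsound, hcompl⟩ := hs
  refine ⟨hl.of_eq ?_ ?_ ?_ ?_, ?_, ?_, by omega, by omega, hgap, hfirst, hlast, ?_, ?_⟩
  · intro k hk; simp [show k ≠ 8 by omega, show k ≠ 9 by omega]
  · simp
  · simp
  · simp
  · simp
  · simp
  -- A parent's value is that of one of its children, and both lie in the old range because `lo` is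
  -- even and `hi` is odd. So the invariant never mentions the set of leaves below a node, and `n`
  -- need not be a power of two.
  · intro p hp1 hp2
    simp only [State.putI_rarr]
    obtain ⟨-, -, ⟨hw, hg⟩ | ⟨hw, hg⟩⟩ := hl.ready.node p (by omega) (by omega) <;> rw [hw, hg]
    · exact hsound _ (by omega) (by omega)
    · exact hsound _ (by omega) (by omega)
  · intro k hk1 hk2
    simp only [State.putI_rarr, State.putI_rreg]
    refine (hcompl k hk1 hk2).imp id ?_
    rintro ⟨p, hp1, hp2, hp⟩
    obtain ⟨hw, hg, -⟩ := hl.ready.node (p / 2) (by omega) (by omega)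
    refine ⟨p / 2, by omega, by omega, hp.trans ?_⟩
    rcases Nat.mod_two_eq_zero_or_one p with hp0 | hp0
    · rwa [show 2 * (p / 2) = p by omega] at hw
    · rwa [show 2 * (p / 2) + 1 = p by omega] at hg

/-- An odd `lo` is a right child and an even `hi` a left child, so their siblings are outside the
range and they must be compared directly. What is left consists of whole sibling pairs, so passing
to parents at least halves the range. -/
theorem run_climb (h : Shortcut x n i j e) (h₁ : IsLast x n A k₁)
    (h₂ : IsLast x n B k₂) (hM : 2 * n ≤ M) (hs : Scanning x n i j e A B k₁ k₂ lo hi s)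
    (hle : lo ≤ hi) : Run d M climb s 33 (fun s' => ∃ lo' hi',
      Scanning x n i j e A B k₁ k₂ lo' hi' s' ∧ hi' + 1 - lo' ≤ (hi + 1 - lo) / 2) := by
  have hpos := hs.pos
  have htop := hs.top
  refine Run.seq (T := 3) (U := 12 + (3 + (12 + 3))) (Run.code ?_)
  simp [hs.i8]
  refine ⟨by omega, by omega, ?_⟩
  refine (Run.andThen (T := 12) (U := 3 + (12 + 3))
    (R := Scanning x n i j e A B k₁ k₂ ((lo + 1) / 2 * 2) hi)
    (Run.branch (T := 1) (U := 11) (fun hb => Run.skip ?_) (fun hb => ?_)) ?_).mono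
    (by norm_num) fun _ h => h
  · simp [Test.holds, hs.i8] at hb
    rw [show (lo + 1) / 2 * 2 = lo by omega]
    exact hs.scratch _ _
  · simp [Test.holds, hs.i8] at hb
    rw [show (lo + 1) / 2 * 2 = lo + 1 by omega]
    exact run_takeLow h h₁ h₂ hM (hs.scratch _ _) hle
  clear hs
  intro s hs
  refine Run.seq (T := 3) (U := 12 + 3) (Run.code ?_)
  simp [hs.i9]
  refine ⟨by omega, by omega, ?_⟩
  refine (Run.andThen (T := 12) (U := 3)
    (R := Scanning x n i j e A B k₁ k₂ ((lo + 1) / 2 * 2) ((hi + 1) / 2 * 2 - 1))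
    (Run.branch (T := 11) (U := 1) (fun hb => ?_) (fun hb => Run.skip ?_)) ?_).mono
    (by norm_num) fun _ h => h
  · simp [Test.holds, hs.i9] at hb
    rw [show (hi + 1) / 2 * 2 - 1 = hi - 1 by omega]
    -- The range is still nonempty here: `hi` is even, so rounding `lo` up to an even number does
    -- not pass it.
    exact run_takeHigh h h₁ h₂ hM (hs.scratch _ _) (by omega)
  · simp [Test.holds, hs.i9] at hb
    rw [show (hi + 1) / 2 * 2 - 1 = hi by omega]
    exact hs.scratch _ _
  clear hs
  intro s hs
  refine Run.code ?_
  simp [hs.i8, hs.i9]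
  refine ⟨by omega, by omega, (lo + 1) / 2, ((hi + 1) / 2 * 2 - 1) / 2, ?_, by omega⟩
  simpa using hs.parents (by omega) (by omega)

/-- Compare all gaps between `R[12]` and `R[13]`; `I[5]` is the first vertex after `R[12]`, and
`I[10]` the last vertex before `R[13]`. -/
def scanGaps : Prog :=
  .seq (code [.rload 16 0 5, .rsub 14 16 12, .radd 15 12 12, .rhalf 15 15, .rload 16 0 10,
    .rsub 17 13 16]) <|
  .seq takeGap <|
  .seq (code [.iadd 8 5 2, .iadd 9 10 2, .isub 9 9 4]) <|
  .loop (.ile 8 9) climb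

/-- `R[14], R[15] :=` the length and the first end of the widest gap on the path. -/
def findGap : Prog :=
  .seq (code [.rsub 12 6 5]) <| .seq (maxInto 12 2) <|
  .seq (code [.radd 12 12 2, .radd 10 12 12, .rhalf 10 10]) <| .seq locate <|
  .seq (code [.iadd 8 10 3, .rsub 13 2 5]) <| .seq (maxInto 13 6) <|
  .seq (code [.rsub 13 3 13, .radd 10 13 13, .rhalf 10 10]) <| .seq locate <|
  .seq (code [.iadd 5 8 4]) <|
  .branch (.ile 5 10) scanGaps (code [.rsub 14 13 12, .radd 15 12 12, .rhalf 15 15])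

theorem run_scanGaps (h : Shortcut x n i j e) (hA : x i ≤ A) (h₁ : IsLast x n A k₁)
    (h₂ : IsLast x n B k₂) (hM : 2 * n ≤ M) (hm : n < 2 ^ m) (hs : Loaded x n i j e s)
    (h12 : s.rreg 12 = A) (h13 : s.rreg 13 = B) (h5 : s.ireg 5 = k₁ + 1) (h10 : s.ireg 10 = k₂)
    (hlt : k₁ < k₂) : Run d M scanGaps s (34 * m + 20) (fun s' => Loaded x n i j e s' ∧
      IsGap x i j A B (s'.rreg 15) (s'.rreg 14) ∧ BoundsGaps x A B k₁ k₂ (s'.rreg 14)) := by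
  have hn := h.lt
  have hk₂ := h₂.lt
  have hAk := h₁.next (by omega)
  have hBk := h₂.le
  have h12' := h.mono (show k₁ + 1 ≤ k₂ from hlt) hk₂
  have hk₁i : i ≤ k₁ := h.le_of_isLast h₁ (h.le.trans_lt hn) hA
  have hp1 := hs.ready.pos (k₁ + 1) (by omega)
  have hp2 := hs.ready.pos k₂ hk₂
  have h2 := hs.ready.two
  have h4 := hs.ready.four
  refine (Run.seq (T := 7) (U := 6 + (4 + (34 * m + 1))) (Run.code ?_)).mono (by omega)
    fun _ h => h
  simp [h12, h13, h5, h10, hp1, hp2]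
  refine Run.seq (run_takeGap fun w g hwg hw1 hw2 => Run.seq (T := 4) (Run.code ?_))
  simp at hwg hw1 hw2
  simp [h5, h10, h2, h4]
  refine ⟨by omega, by omega, by omega, ?_⟩
  let I : ℕ → State → Prop := fun m s' => ∃ lo hi, Scanning x n i j e A B k₁ k₂ lo hi s' ∧
    hi + 1 - lo < 2 ^ m
  -- The scan starts with the leaves of the edges from `k₁ + 1` to `k₂ - 1`, those with both ends
  -- after `A` and not beyond `B`. The range is empty if `k₂ = k₁ + 1`.
  refine (Run.loop (T := 33) (I := I) ?_ ?_ ⟨k₁ + 1 + n, k₂ + n - 1,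
    ⟨hs.of_eq ?_ ?_ ?_ ?_, ?_, ?_, by omega, by omega, ?_, ?_, ?_, ?_, ?_⟩, by omega⟩).mono
    le_rfl ?_
  · rintro s' ⟨lo, hi, hs', hlt⟩
    simp [Test.holds, hs'.i8, hs'.i9] at hlt ⊢
    omega
  · rintro m s' ⟨lo, hi, hs', hlt⟩ hb
    simp [Test.holds, hs'.i8, hs'.i9] at hb
    refine (run_climb h h₁ h₂ hM hs' hb).mono le_rfl ?_
    rintro s₂ ⟨lo', hi', hs₂, hle⟩
    have hp : 2 ^ (m + 1) = 2 * 2 ^ m := by ring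
    exact ⟨lo', hi', hs₂, by omega⟩
  · intro k hk; simp [show k ≠ 8 by omega, show k ≠ 9 by omega]
  · simp
  · intro k h2 hk
    simp [show k ≠ 14 by omega, show k ≠ 15 by omega, show k ≠ 16 by omega, show k ≠ 17 by omega]
  · simp
  · simp
  · simp
  · simp
    -- The initial candidate is the longer of the end pieces, from `A` to the vertex `k₁ + 1` or
    -- from the vertex `k₂` to `B`.
    rcases hwg with ⟨rfl, rfl⟩ | ⟨rfl, rfl⟩
    · refine ⟨by linarith, le_rfl, by linarith, fun l hil hlj => ?_⟩
      rcases le_or_gt l k₁ with hl | hl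
      · exact Or.inl ((h.mono hl h₁.lt).trans h₁.le)
      · exact Or.inr (by linarith [h.mono (show k₁ + 1 ≤ l from hl) (by omega)])
    · refine ⟨by linarith, by linarith, by linarith, fun l hil hlj => ?_⟩
      rcases le_or_gt l k₂ with hl | hl
      · exact Or.inl (h.mono hl hk₂)
      · exact Or.inr (by linarith [h.lt_of_isLast h₂ (by omega) hl])
  · simpa using hw1
  · simpa using hw2
  · intro p hp1 hp2
    simp
    obtain ⟨hl1, hl2⟩ := hs.ready.leaf (p - n) (by omega)
    rw [show n + (p - n) = p by omega] at hl1 hl2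
    exact ⟨p - n, by omega, by omega, hl1, hl2⟩
  · intro k hk1 hk2
    refine Or.inr ⟨n + k, by omega, by omega, ?_⟩
    simpa using (hs.ready.leaf k (by omega)).1.ge
  · rintro s' ⟨hb, -, lo, hi, hs', -⟩
    simp [Test.holds, hs'.i8, hs'.i9] at hb
    refine ⟨hs'.loaded, hs'.gap, fun hle => by omega, fun _ => ⟨hs'.first, hs'.last, ?_⟩⟩
    intro k hk1 hk2
    rcases hs'.complete k hk1 hk2 with hc | ⟨p, hp1, hp2, -⟩
    · exact hc
    · omega

theorem run_findGap (h : Shortcut x n i j e) (hs : Loaded x n i j e s) (hM : 2 * n ≤ M)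
    (hm : n < 2 ^ m) (hA : A = max (x (n - 1) - x j - e) (x i) + x i)
    (hB : B = x j - max (x i - e) (x (n - 1) - x j)) (hAB : A ≤ B) :
    Run d M findGap s (60 * m + 80) (fun s' => Loaded x n i j e s' ∧
      IsGap x i j A B (s'.rreg 15) (s'.rreg 14) ∧
      ∃ k₁ k₂, IsLast x n A k₁ ∧ IsLast x n B k₂ ∧ BoundsGaps x A B k₁ k₂ (s'.rreg 14)) := by
  have hn := h.lt
  have hi0 := h.nonneg_pos (h.le.trans_lt hn)
  have hX := h.le_last hn
  have hiA : x i ≤ A := by linarith [le_max_right (x (n - 1) - x j - e) (x i)]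
  have hBj : B ≤ x j := by linarith [le_max_right (x i - e) (x (n - 1) - x j)]
  refine (Run.seq (T := 2) (U := 4 + (4 + ((8 * m + 4) + (3 + (4 + (4 + ((8 * m + 4) + (2 +
    (max (34 * m + 20) 4 + 1))))))))) (Run.code ?_)).mono (by omega) fun _ h => h
  simp [hs.r5, hs.r6]
  refine Run.seq (run_maxInto (Run.seq (T := 4) (Run.code ?_)))
  simp [hs.r2, ← hA]
  refine Run.andThen (R := fun s' => Loaded x n i j e s' ∧ s'.rreg 12 = A ∧
    IsLast x n A (s'.ireg 10)) ?_ ?_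
  · refine (run_locate (hs.ready.of_eq ?_ ?_ ?_ ?_ ?_) (by omega) hM hm h.strict ?_).mono le_rfl ?_
    · simp
    · simp
    · simp
    · simp
    · simp
    · simp [h.zero]; linarith
    · rintro s' ⟨hk, hl⟩
      refine ⟨Loaded.keeps (hs.of_eq ?_ ?_ ?_ ?_) hk, ?_, ?_⟩
      · simp
      · simp
      · intro k _ _; simp [show k ≠ 10 by omega, show k ≠ 12 by omega]
      · simp
      · rw [hk.rreg 12 (by norm_num)]; simp
      · simpa using hl
  clear hs
  rintro s ⟨hs, h12, hl⟩
  have h3 := hs.ready.three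
  have hlt := hl.lt
  refine Run.seq (T := 3) (Run.code ?_)
  simp [h3, hs.r2, hs.r5]
  refine ⟨by omega, ?_⟩
  refine Run.seq (run_maxInto (Run.seq (T := 4) (Run.code ?_)))
  simp [hs.r3, hs.r6, ← hB]
  refine Run.andThen (R := fun s' => Loaded x n i j e s' ∧ s'.rreg 12 = A ∧ s'.rreg 13 = B ∧
    IsLast x n A (s'.ireg 8) ∧ IsLast x n B (s'.ireg 10)) ?_ ?_
  · refine (run_locate (hs.ready.of_eq ?_ ?_ ?_ ?_ ?_) (by omega) hM hm h.strict ?_).mono le_rfl ?_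
    · simp
    · simp
    · simp
    · simp
    · simp
    · simp [h.zero]; linarith
    · rintro s' ⟨hk, hl'⟩
      refine ⟨Loaded.keeps (hs.of_eq ?_ ?_ ?_ ?_) hk, ?_, ?_, ?_, ?_⟩
      · intro k _; simp [show k ≠ 8 by omega]
      · simp
      · intro k _ _; simp [show k ≠ 10 by omega, show k ≠ 13 by omega]
      · simp
      · rw [hk.rreg 12 (by norm_num)]; simpa using h12
      · rw [hk.rreg 13 (by norm_num)]; simp
      · rw [hk.ireg 8 (by norm_num)]; simpa using hl
      · simpa using hl'
  clear hs h12 hl hlt h3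
  rintro s ⟨hs, h12, h13, hl₁, hl₂⟩
  have h4 := hs.ready.four
  have hlt := hl₁.lt
  refine Run.seq (T := 2) (Run.code ?_)
  simp [h4]
  refine ⟨by omega, (Run.branch (T := 34 * m + 20) (U := 4) (fun hb => ?_)
    (fun hb => Run.code ?_)).mono (by omega) fun _ h => h⟩
  · simp [Test.holds] at hb
    refine (run_scanGaps h hiA hl₁ hl₂ hM hm (hs.of_eq ?_ ?_ ?_ ?_) ?_ ?_ ?_ ?_ hb).mono
      le_rfl ?_
    · intro k hk; simp [show k ≠ 5 by omega]
    · simp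
    · simp
    · simp
    · simpa using h12
    · simpa using h13
    · simp
    · simp
    · rintro s' ⟨hs', hgap, hb⟩
      exact ⟨hs', hgap, _, hl₁, _, hl₂, hb⟩
  · simp [Test.holds] at hb
    simp [h12, h13]
    refine ⟨hs.of_eq ?_ ?_ ?_ ?_, ⟨by linarith, le_rfl, by linarith, ?_⟩, _, hl₁, _, hl₂,
      fun _ => le_rfl, fun hlt => by omega⟩
    · intro k hk; simp [show k ≠ 5 by omega]
    · simp
    · intro k _ _; simp [show k ≠ 14 by omega, show k ≠ 15 by omega]
    · simp
    -- No vertex lies strictly between `A` and `B`, so the whole interval is the gap.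
    · intro l hil hlj
      rcases le_or_gt l (s.ireg 8) with hl | hl
      · exact Or.inl ((h.mono hl hl₁.lt).trans hl₁.le)
      · exact Or.inr (by linarith [h.lt_of_isLast hl₂ (by omega) (hb.trans_lt hl)])

end RealRAM

/-! ### From the widest gap to the answer of a query -/

namespace RealRAM

open AugPath

variable {n : ℕ} {d : Fin n → Fin n → ℝ} {M : ℕ} {x : ℕ → ℝ} {i j m : ℕ} {e : ℝ} {s : State}

/-- `s` shows a center and the radius. -/
structure Answered (x : ℕ → ℝ) (n i j : ℕ) (e : ℝ) (s : State) : Prop where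
  ready : Ready x n s
  lower : IsLowerBound x n i j e (s.rreg 1)
  center : (∃ z, z ≤ x (n - 1) ∧ (∀ l < n, lineDist (x i) (x j) e z (x l) ≤ s.rreg 1) ∧
      ShowsPosition x n z s) ∨
    (0 ≤ s.rreg 0 ∧ s.rreg 0 ≤ e ∧
      (∀ l < n, shortcutDist (x i) (x j) e (s.rreg 0) (x l) ≤ s.rreg 1) ∧
      s.ireg 0 = i ∧ s.ireg 1 = j)

theorem run_showPosition_answered (h : Shortcut x n i j e) (hs : Ready x n s) (hM : 2 * n ≤ M)
    (hm : n < 2 ^ m) (hz : 0 ≤ s.rreg 10) (hz' : s.rreg 10 ≤ x (n - 1))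
    (hlow : IsLowerBound x n i j e (s.rreg 1))
    (hup : ∀ l < n, lineDist (x i) (x j) e (s.rreg 10) (x l) ≤ s.rreg 1) :
    Run d M showPosition s (8 * m + 12) (Answered x n i j e) := by
  refine (run_showPosition h hs hM hm hz).mono le_rfl ?_
  rintro s' ⟨hs', hp, h1⟩
  exact ⟨hs', h1 ▸ hlow, Or.inl ⟨_, hz', h1 ▸ hup, hp⟩⟩

/-- Show the antipode of the midpoint of the widest gap of the cycle, given the widest gap on the
path. -/
def showGapCenter : Prog :=
  .seq (code [.rsub 16 5 2, .rsub 16 16 6, .radd 17 7 5, .rhalf 17 17]) <|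
  .branch (.rle 16 14)
    (.seq (code [.rhalf 18 14, .rsub 1 17 18, .radd 18 15 18, .radd 10 18 17, .radd 19 2 17,
        .radd 0 3 5, .rsub 0 0 10]) <|
      .branch (.rle 10 3) showPosition <|
      .branch (.rle 18 19) .skip <|
      .seq (code [.rsub 10 18 17]) showPosition)
    (.seq (code [.rhalf 18 16, .rsub 1 17 18, .radd 10 3 6, .radd 10 10 18, .rsub 10 10 17])
      showPosition)

theorem run_showGapCenter {R R' A B : ℝ} {k₁ k₂ : ℕ} (h : Shortcut x n i j e)
    (hs : Loaded x n i j e s) (hM : 2 * n ≤ M) (hm : n < 2 ^ m)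
    (hR : IsReachRight x n i j e R) (hR' : IsReachLeft x i j e R') (ha : x i < R)
    (hb : x (n - 1) - x j < R')
    (hA : A = max (x (n - 1) - x j - e) (x i) + x i)
    (hB : B = x j - max (x i - e) (x (n - 1) - x j))
    (hgap : IsGap x i j A B (s.rreg 15) (s.rreg 14))
    (h₁ : IsLast x n A k₁) (h₂ : IsLast x n B k₂) (hbd : BoundsGaps x A B k₁ k₂ (s.rreg 14)) :
    Run d M showGapCenter s (8 * m + 40) (Answered x n i j e) := by
  have hn := h.lt
  have he := h.nonneg
  have hsh := h.short
  have hi0 := h.nonneg_pos (h.le.trans_lt hn)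
  have hX := h.le_last hn
  have hA1 := le_max_right (x (n - 1) - x j - e) (x i)
  have hA2 := le_max_left (x (n - 1) - x j - e) (x i)
  have hB1 := le_max_right (x i - e) (x (n - 1) - x j)
  have hB2 := le_max_left (x i - e) (x (n - 1) - x j)
  obtain ⟨hw0, hgA, hgB, hfree⟩ := hgap
  generalize hw : s.rreg 14 = w at hw0 hgB hfree hbd
  generalize hg : s.rreg 15 = g at hgA hgB hfree
  -- One lower bound serves both outcomes; `ρ` will be half the length of the wider of the path gap
  -- and the shortcut gap.
  have hlow : ∀ ρ, 0 ≤ ρ → w ≤ 2 * ρ → e - x i - (x (n - 1) - x j) ≤ 2 * ρ →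
      IsLowerBound x n i j e ((x j - x i + e) / 2 - ρ) := by
    intro ρ h0 h1 h2
    refine h.isLowerBound_of_far hR hR' ha hb fun θ hθ hθ' => h.far_of_gaps h0 ?_ ?_
      (fun φ => h.close_of_boundsGaps (by linarith) (by linarith) h₁ h₂ hbd h1) h2 hθ hθ'
    · rcases max_choice (x (n - 1) - x j - e) (x i) with hc | hc <;> rw [hc] at hA
      · right; linarith
      · left; linarith
    · rcases max_choice (x i - e) (x (n - 1) - x j) with hc | hc <;> rw [hc] at hB
      · right; linarith
      · left; linarith
  refine (Run.seq (T := 5) (U := max (8 + (max (8 * m + 12) (max 1 (2 + (8 * m + 12)) + 1) + 1))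
    (6 + (8 * m + 12)) + 1) (Run.code ?_)).mono (by omega) fun _ h => h
  simp only [post_rsub, post_radd, post_rhalf, post_nil]
  refine Run.branch (fun hc => ?_) (fun hc => ?_)
  · simp [Test.holds, hs.r2, hs.r5, hs.r6, hw] at hc
    have hlow := hlow (w / 2) (by linarith) (by linarith) (by linarith)
    have hnear : ∀ θ, _ → x i ≤ θ → θ ≤ x j + e → Near x n i j e _ θ := fun θ =>
      h.near_of_gap (θ := θ) hw0 (by linarith) (by linarith) (by linarith) (by linarith) hgA hgB
        hfree
    refine Run.seq (Run.code ?_)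
    simp [hs.r2, hs.r3, hs.r5, hs.r6, hs.r7, hw, hg]
    -- The antipode of the midpoint is half the cycle ahead. It is on the path if its coordinate is
    -- at most `x j`, on the shortcut if it is at most `x j + e`, and otherwise the whole cycle has
    -- to be subtracted, which leads back to the path.
    refine (Run.branch (T := 8 * m + 12) (U := max 1 (2 + (8 * m + 12)) + 1)
      (fun hc' => ?_) (fun hc' => (Run.branch (fun hd => Run.skip ?_)
      (fun hd => Run.seq (Run.code ?_))))).mono (by omega) fun _ h => h
    · simp [Test.holds, hs.r3] at hc'
      refine run_showPosition_answered h (hs.ready.of_eq ?_ ?_ ?_ ?_ ?_) hM hm ?_ ?_ ?_ ?_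
      · simp
      · simp
      · simp
      · simp
      · simp
      · simp; linarith
      · simp; linarith
      · simpa using hlow
      · intro l hl
        simpa using h.lineDist_le_of_near (by linarith) hc'
          (hnear _ (Or.inl rfl) (by linarith) (by linarith)) hl
    · simp [Test.holds, hs.r3] at hc' hd
      refine ⟨hs.ready.of_eq ?_ ?_ ?_ ?_ ?_, ?_, Or.inr ⟨?_, ?_, ?_, ?_, ?_⟩⟩
      · simp
      · simp
      · simp
      · simp
      · simp
      · simpa using hlow
      · simp; linarith
      · simp; linarith
      · intro l hl
        have := h.shortcutDist_le_of_near (r := (x j - x i + e) / 2 - w / 2)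
          (t := x j + e - (g + w / 2 + (x j - x i + e) / 2)) (by linarith) (by linarith)
          (by rw [sub_sub_cancel]; exact hnear _ (Or.inl rfl) (by linarith) (by linarith)) hl
        simpa using this
      · simpa using hs.i0
      · simpa using hs.i1
    · simp [Test.holds, hs.r3] at hc' hd
      simp
      refine run_showPosition_answered h (hs.ready.of_eq ?_ ?_ ?_ ?_ ?_) hM hm ?_ ?_ ?_ ?_
      · simp
      · simp
      · simp
      · simp
      · simp
      · simp; linarith
      · simp; linarith
      · simpa using hlow
      · intro l hl
        simpa using h.lineDist_le_of_near (by linarith) (by linarith)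
          (hnear _ (Or.inr rfl) (by linarith) (by linarith)) hl
  · simp [Test.holds, hs.r2, hs.r5, hs.r6, hw] at hc
    -- The gap on the shortcut is the wider one. The antipode of its midpoint is on the path, since
    -- the path between `i` and `j` is at least as long as the shortcut.
    have hlow := hlow ((e - x i - (x (n - 1) - x j)) / 2) (by linarith) (by linarith) (by linarith)
    refine Run.seq (Run.code ?_)
    simp only [post_rsub, post_radd, post_rhalf, post_nil]
    refine run_showPosition_answered h (hs.ready.of_eq ?_ ?_ ?_ ?_ ?_) hM hm ?_ ?_ ?_ ?_
    · simp
    · simp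
    · simp
    · simp
    · simp
    · simp [hs.r2, hs.r3, hs.r5, hs.r6, hs.r7]; linarith
    · simp [hs.r2, hs.r3, hs.r5, hs.r6, hs.r7]; linarith
    · simpa [hs.r2, hs.r3, hs.r5, hs.r6, hs.r7] using hlow
    · intro l hl
      have := h.lineDist_le_of_near (by linarith) (by linarith)
        (h.near_of_shortcut_gap (by linarith) rfl) hl
      simpa [hs.r2, hs.r3, hs.r5, hs.r6, hs.r7] using this

/-- Answer a query. -/
def query : Prog :=
  .seq loadQuery <| .seq reachRight <| .seq reachLeft <|
  .branch (.rle 8 2)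
    (.seq (code [.radd 1 2 8, .rhalf 1 1, .radd 10 1 1, .rhalf 10 10]) showPosition) <|
  .branch (.rle 9 6)
    (.seq (code [.radd 1 6 9, .rhalf 1 1, .rsub 10 4 1]) showPosition) <|
  .seq (code [.radd 12 2 6]) <|
  .branch (.rle 7 12)
    (code [.radd 1 12 5, .rhalf 1 1, .radd 0 6 5, .rsub 0 0 2, .rhalf 0 0])
    (.seq findGap showGapCenter)

theorem run_query {i j : Fin n} (hd : IsDist d) (hs : Ready (pathPos d) n s) (hM : 2 * n ≤ M)
    (hm : n < 2 ^ m) (hij : (s.ireg 0 = i ∧ s.ireg 1 = j) ∨ (s.ireg 0 = j ∧ s.ireg 1 = i))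
    (hle : i ≤ j) :
    Run d M query s (84 * m + 240) (Answered (pathPos d) n i j (d i j)) := by
  have h := hd.shortcut hle
  have hn := h.lt
  have he := h.nonneg
  have hi0 := h.nonneg_pos (h.le.trans_lt hn)
  have hX := h.le_last hn
  have hji := h.mono h.le hn
  refine (Run.andThen (T := 20) (U := (8 * m + 40) + ((8 * m + 40) + (max (5 + (8 * m + 12))
    (max (4 + (8 * m + 12)) (2 + (max 6 ((60 * m + 80) + (8 * m + 40)) + 1)) + 1) + 1)))
    (run_loadQuery hs hM hij hle) ?_).mono (by omega) fun _ h => h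
  clear hs
  intro s hs
  refine Run.andThen (run_reachRight h hs hM hm) ?_
  clear hs
  rintro s ⟨hs, hR⟩
  refine Run.andThen (run_reachLeft h hs hM hm) ?_
  rintro s' ⟨hs', h8, hR'⟩
  -- `reachLeft` has kept the value of `R[8]`, so both reaches are available from here on.
  rw [← h8] at hR
  clear hs h8
  generalize hRe : s'.rreg 8 = R at hR
  generalize hRe' : s'.rreg 9 = R' at hR'
  have hR0 := h.le_reachRight hR
  have hR0' := h.le_reachLeft hR'
  refine Run.branch (fun hb => Run.seq (Run.code ?_)) (fun hb => Run.branch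
    (fun hb' => Run.seq (Run.code ?_)) (fun hb' => Run.seq (Run.code ?_)))
  · simp [Test.holds, hRe, hs'.r2] at hb
    simp [hRe, hs'.r2]
    refine run_showPosition_answered h (hs'.ready.of_eq ?_ ?_ ?_ ?_ ?_) hM hm ?_ ?_ ?_ ?_
    · simp
    · simp
    · simp
    · simp
    · simp
    · simp; linarith
    · simp; linarith
    · simpa using h.isLowerBound_of_reachRight_le hR hb
    · intro l hl
      simpa using h.lineDist_le_of_reachRight_le hR hb hl
  · simp [Test.holds, hRe', hs'.r6] at hb'
    simp [hRe', hs'.r4, hs'.r6]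
    refine run_showPosition_answered h (hs'.ready.of_eq ?_ ?_ ?_ ?_ ?_) hM hm ?_ ?_ ?_ ?_
    · simp
    · simp
    · simp
    · simp
    · simp
    · simp; linarith
    · simp; linarith
    · simpa using h.isLowerBound_of_reachLeft_le hR' (by linarith)
    · intro l hl
      simpa using h.lineDist_le_of_reachLeft_le hR' (by linarith) hl
  · simp only [Test.holds, hRe, hRe', hs'.r2, hs'.r6, not_le] at hb hb'
    simp only [post_radd, post_nil, hs'.r2, hs'.r6]
    refine Run.branch (fun hc => Run.code ?_) (fun hc => ?_)
    · simp [Test.holds, hs'.r7] at hc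
      obtain ⟨h1, h2⟩ := h.le_add_of_reach hR hR' hb hb' (by linarith)
      simp [hs'.r2, hs'.r5, hs'.r6]
      refine ⟨hs'.ready.of_eq ?_ ?_ ?_ ?_ ?_, ?_, Or.inr ⟨?_, ?_, ?_, ?_, ?_⟩⟩
      · simp
      · simp
      · simp
      · simp
      · simp
      · simpa using h.isLowerBound_of_far hR hR' hb hb' fun θ => h.far_of_cover
      · simp; linarith
      · simp; linarith
      · intro l hl
        simpa using h.shortcutDist_le_of_near (by linarith) (by linarith)
          (h.near_of_cover (by linarith) h2) hl
      · simpa using hs'.i0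
      · simpa using hs'.i1
    · simp [Test.holds, hs'.r7] at hc
      have hAB := h.add_lt_of_reach hR hR' hb hb' (by linarith)
      rw [max_comm (pathPos d i), max_comm (pathPos d (n - 1) - _)] at hAB
      refine Run.andThen (run_findGap h (hs'.of_eq ?_ ?_ ?_ ?_) hM hm rfl rfl (by linarith)) ?_
      · simp
      · simp
      · intro k _ _; simp [show k ≠ 12 by omega]
      · simp
      · rintro s₂ ⟨hs₂, hgap, k₁, k₂, h₁, h₂, hbd⟩
        exact run_showGapCenter h hs₂ hM hm hR hR' hb hb' rfl rfl hgap h₁ h₂ hbd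

/-! ## Preprocessing -/

/-- Store the position of the vertex `I[5]` and the edge before it. -/
def addVertex : Prog :=
  code [.isub 7 5 4, .dist 1 7 5, .rload 0 0 7, .iadd 8 7 2, .rstore 1 8 1, .rstore 2 8 0,
    .radd 0 0 1, .rstore 0 5 0, .iadd 5 5 4]

/-- Store the node `I[5]` of the tree. -/
def addNode : Prog :=
  .seq (code [.iadd 7 5 5, .iadd 8 7 4, .rload 0 1 7, .rload 1 1 8]) <|
  .seq (.branch (.rle 0 1) (code [.iadd 7 8 3]) .skip) <|
  code [.rload 0 1 7, .rload 1 2 7, .rstore 1 5 0, .rstore 2 5 1, .isub 5 5 4]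

/-- Store the positions of the vertices and the tree over the edges. -/
def preprocess : Prog :=
  .seq (code [.iadd 2 0 3, .iconst 4 1, .isub 6 2 4, .iconst 5 1]) <|
  .seq (.loop (.ile 5 6) addVertex) <|
  .seq (code [.iadd 5 6 3]) (.loop (.ile 4 5) addNode)

/-- The first `k` positions and the edges between them are stored. -/
structure Positioned (x : ℕ → ℝ) (n k : ℕ) (s : State) : Prop where
  two : s.ireg 2 = n
  three : s.ireg 3 = 0
  four : s.ireg 4 = 1
  five : s.ireg 5 = k
  six : s.ireg 6 = n - 1
  pos : ∀ l < k, s.rarr 0 l = x l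
  leaf : ∀ l, l + 1 < k → s.rarr 1 (n + l) = x (l + 1) - x l ∧ s.rarr 2 (n + l) = x l

theorem run_addVertex {k : ℕ} (hk : k + 1 < n) (hM : 2 * n ≤ M)
    (hs : Positioned (pathPos d) n (k + 1) s) :
    Run d M addVertex s 10 (Positioned (pathPos d) n (k + 2)) := by
  obtain ⟨h2, h3, h4, h5, h6, hpos, hleaf⟩ := hs
  have hp := hpos k (Nat.lt_succ_self k)
  have hx := pathPos_succ (d := d) k
  rw [pathEdge_of_lt hk] at hx
  refine Run.code ?_
  simp [h2, h4, h5, hp]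
  refine ⟨by omega, by omega, by omega, by omega, ?_, ?_, ?_, ?_, ?_, ?_, ?_⟩
  · simpa using h2
  · simpa using h3
  · simpa using h4
  · simp
  · simpa using h6
  · intro l hl
    rcases (show l ≤ k + 1 by omega).eq_or_lt with rfl | hlt
    · simp [hx]
    · simpa [show l ≠ k + 1 by omega] using hpos l hlt
  · intro l hl
    rcases (show l ≤ k by omega).eq_or_lt with rfl | hlt
    · simp [add_comm, hx]
    · simpa [show n + l ≠ k + n by omega] using hleaf l (by omega)

/-- All positions and edges, and the nodes of the tree after `p`, are stored. -/
structure Treed (x : ℕ → ℝ) (n p : ℕ) (s : State) : Prop where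
  two : s.ireg 2 = n
  three : s.ireg 3 = 0
  four : s.ireg 4 = 1
  five : s.ireg 5 = p
  six : s.ireg 6 = n - 1
  pos : ∀ l < n, s.rarr 0 l = x l
  leaf : ∀ l, l + 1 < n → s.rarr 1 (n + l) = x (l + 1) - x l ∧ s.rarr 2 (n + l) = x l
  node : ∀ q, p < q → q < n → s.rarr 1 (2 * q) ≤ s.rarr 1 q ∧ s.rarr 1 (2 * q + 1) ≤ s.rarr 1 q ∧
    ((s.rarr 1 q = s.rarr 1 (2 * q) ∧ s.rarr 2 q = s.rarr 2 (2 * q)) ∨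
      (s.rarr 1 q = s.rarr 1 (2 * q + 1) ∧ s.rarr 2 q = s.rarr 2 (2 * q + 1)))

theorem run_addNode {p : ℕ} (hp : p + 1 < n) (hM : 2 * n ≤ M) (hs : Treed x n (p + 1) s) :
    Run d M addNode s 14 (Treed x n p) := by
  obtain ⟨h2, h3, h4, h5, h6, hpos, hleaf, hnode⟩ := hs
  -- `c` is the child with the larger value. The stores go to index `p + 1`, which is neither a leaf
  -- nor a child of a node at or after `p + 1`, so nothing already established is overwritten.
  have key : ∀ c s', (c = 2 * (p + 1) ∨ c = 2 * (p + 1) + 1) →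
      s.rarr 1 (2 * (p + 1)) ≤ s.rarr 1 c → s.rarr 1 (2 * (p + 1) + 1) ≤ s.rarr 1 c →
      (∀ k < 7, s'.ireg k = s.ireg k) → s'.rarr = s.rarr → s'.ireg 7 = c →
      Run d M (code [.rload 0 1 7, .rload 1 2 7, .rstore 1 5 0, .rstore 2 5 1, .isub 5 5 4]) s' 6
        (Treed x n p) := by
    intro c s' hc hc1 hc2 hi hr h7
    refine Run.code ?_
    simp [hi, hr, h7, h5, h4]
    refine ⟨by omega, ?_, ?_, ?_, ?_, ?_, ?_, ?_, ?_⟩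
    · simpa [hi] using h2
    · simpa [hi] using h3
    · simpa [hi] using h4
    · simp
    · simpa [hi] using h6
    · simpa [hr] using hpos
    · intro l hl
      simpa [hr, show n + l ≠ p + 1 by omega] using hleaf l hl
    · intro q hq hqn
      rcases (show p + 1 ≤ q from hq).eq_or_lt with rfl | hlt
      · simp [hr, show 2 * (p + 1) ≠ p + 1 by omega, show 2 * (p + 1) ≠ p by omega]
        refine ⟨hc1, hc2, ?_⟩
        rcases hc with rfl | rfl
        · left; simp
        · right; simp
      · simpa [hr, show q ≠ p + 1 by omega, show 2 * q ≠ p + 1 by omega,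
          show 2 * q ≠ p by omega] using hnode q hlt hqn
  refine Run.seq (T := 5) (U := (max 2 1 + 1) + 6) (Run.code ?_)
  simp [h4, h5]
  refine ⟨by omega, by omega, Run.seq (T := 3) (U := 6)
    (Run.branch (T := 2) (U := 1) (fun hb => Run.code ?_) (fun hb => Run.skip ?_))⟩ <;>
    simp [Test.holds] at hb
  · simp [h3]
    rw [← two_mul] at hb ⊢
    refine ⟨by omega, key (2 * (p + 1) + 1) _ (Or.inr rfl) hb le_rfl ?_ ?_ ?_⟩
    · intro k hk; simp [show k ≠ 7 by omega, show k ≠ 8 by omega]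
    · simp
    · simp
  · rw [← two_mul] at hb ⊢
    refine key (2 * (p + 1)) _ (Or.inl rfl) le_rfl hb.le ?_ ?_ ?_
    · intro k hk; simp [show k ≠ 7 by omega, show k ≠ 8 by omega]
    · simp
    · simp

theorem run_preprocess (hn : 1 ≤ n) (hM : 2 * n ≤ M) :
    Run d M preprocess (State.start n) (40 * n) (Ready (pathPos d) n) := by
  refine (Run.seq (T := 5) (U := (11 * (n - 1) + 1) + (2 + (15 * (n - 1) + 1)))
    (Run.code ?_)).mono (by omega) fun _ h => h
  simp [State.start]
  refine ⟨by omega, by omega, by omega, by omega, ?_⟩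
  refine Run.andThen (Run.loop (T := 10)
    (I := fun m s => ∃ k, k + 1 + m = n ∧ Positioned (pathPos d) n (k + 1) s) ?_ ?_
    (m := n - 1) ⟨0, by omega, ?_, ?_, ?_, ?_, ?_, ?_, ?_⟩) ?_
  · rintro s ⟨k, hk, hs⟩
    simp only [Test.holds, hs.five, hs.six]
    omega
  · rintro m s ⟨k, hk, hs⟩ -
    exact (run_addVertex (by omega) hM hs).mono le_rfl fun s' hs' => ⟨k + 1, by omega, hs'⟩
  · simp
  · simp
  · simp
  · simp
  · simp
  -- The position of vertex 0 needs no store: it is 0, as is the initial array.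
  · intro l hl
    obtain rfl : l = 0 := by omega
    simp [pathPos_zero]
  · intro l hl
    omega
  rintro s ⟨hb, m, k, hk, hs⟩
  simp only [Test.holds, hs.five, hs.six] at hb
  obtain rfl : k + 1 = n := by omega
  refine Run.seq (T := 2) (Run.code ?_)
  simp [hs.three, hs.six]
  refine ⟨by omega, ?_⟩
  refine (Run.loop (T := 14) (I := fun m s => m ≤ k ∧ Treed (pathPos d) (k + 1) m s)
    (m := k) ?_ ?_ ⟨le_rfl, ?_, ?_, ?_, ?_, ?_, ?_, ?_, ?_⟩).mono le_rfl ?_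
  · rintro s ⟨-, hs⟩
    simp only [Test.holds, hs.five, hs.four]
    omega
  · rintro m s ⟨hm, hs⟩ -
    exact (run_addNode (by omega) hM hs).mono le_rfl fun s' hs' => ⟨by omega, hs'⟩
  · simpa using hs.two
  · simpa using hs.three
  · simpa using hs.four
  · simp
  · simpa using hs.six
  · simpa using hs.pos
  · simpa using hs.leaf
  -- Nodes are filled from `n - 1` down to 1, so at the start none is required.
  · intro q h1 h2
    omega
  · rintro s ⟨hb, p, hp, hs⟩
    simp only [Test.holds, hs.five, hs.four] at hb
    exact ⟨hs.two, hs.three, hs.four, hs.six, hs.pos, hs.leaf, fun q hq => hs.node q (by omega)⟩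

/-! ## All queries -/

theorem Ready.query {s : State} (hs : Ready x n s) (i j : Fin n) : Ready x n (s.query i j) :=
  hs.of_eq (by simp [State.query]) (by simp [State.query]) (by simp [State.query])
    (by simp [State.query]) rfl

theorem query_ireg (s : State) (i j : Fin n) :
    (s.query i j).ireg 0 = i ∧ (s.query i j).ireg 1 = j := by
  simp [State.query]

theorem Answered.shows {i j : Fin n} (hd : IsDist d)
    (hs : Answered (pathPos d) n i j (d i j) s) :
    ∃ (c : Point (graph i j) d) (r : ℝ), s.Shows c r ∧ IsCenter c ∧ IsRadius (graph i j) d r := by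
  obtain ⟨-, hlow, ⟨z, hz, hup, k, hk, h0, h1, h2⟩ | ⟨h0, he, hup, hi, hj⟩⟩ := hs
  · obtain ⟨c, ha, hb, ht, hc⟩ := hd.exists_center_on_path hlow hz hup hk h1
    exact ⟨c, _, ⟨h0.trans ha, hb, h2.trans ht, rfl⟩, hc⟩
  · obtain ⟨c, ha, hb, ht, hc⟩ := hd.exists_center_on_shortcut hlow h0 he hup
    exact ⟨c, _, ⟨hi.trans (congrArg _ ha), hj.trans (congrArg _ hb), ht, rfl⟩, hc⟩

/-- Every query is answered. -/
theorem run_query_shows (hd : IsDist d) (hs : Ready (pathPos d) n s) (hM : 2 * n ≤ M)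
    (hm : n < 2 ^ m) (i j : Fin n) :
    Run d M query (s.query i j) (84 * m + 240) (fun s' => Ready (pathPos d) n s' ∧
      ∃ (c : Point (graph i j) d) (r : ℝ),
        s'.Shows c r ∧ IsCenter c ∧ IsRadius (graph i j) d r) := by
  rcases le_total i j with hij | hij
  · exact (run_query hd (hs.query i j) hM hm (Or.inl (query_ireg s i j)) hij).mono le_rfl
      fun s' hs' => ⟨hs'.ready, hs'.shows hd⟩
  · rw [graph_comm i j]
    exact (run_query hd (hs.query i j) hM hm (Or.inr (query_ireg s i j)) hij).mono le_rfl
      fun s' hs' => ⟨hs'.ready, hs'.shows hd⟩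

/-- `Waiting` speaks of arbitrary runs; determinism identifies them with the runs constructed here.
-/
theorem Waiting.ready (hn : 1 ≤ n) (hd : IsDist d) (hM : 2 * n ≤ M)
    (hs : Waiting d M preprocess RealRAM.query s) : Ready (pathPos d) n s := by
  induction hs with
  | preprocessed he =>
    obtain ⟨s', t, he', -, hs'⟩ := run_preprocess (d := d) hn hM
    rwa [(he.deterministic he').1]
  | answered i j _ he ih =>
    -- Only the final state matters here, so the crude exponent `n` suffices.
    obtain ⟨s', t, he', -, hs', -⟩ := run_query_shows hd ih hM Nat.lt_two_pow_self i j
    rwa [(he.deterministic he').1]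

end RealRAM

open RealRAM AugPath in
theorem theorem2 :
    ∃ (pre qry : Prog) (K C : ℕ),
      ∀ (n : ℕ), 1 ≤ n →
      ∀ (X : Type*) [MetricSpace X] (v : Fin n → X), Function.Injective v →
      ∀ (d : Fin n → Fin n → ℝ), (∀ a b, d a b = dist (v a) (v b)) →
        (∃ (s : State) (t : ℕ), Exec d (K * n) pre (State.start n) s t ∧ t ≤ C * n) ∧
        ∀ (s : State), Waiting d (K * n) pre qry s → ∀ (i j : Fin n),
          ∃ (s' : State) (t : ℕ) (c : Point (graph i j) d) (r : ℝ),
            Exec d (K * n) qry (s.query i j) s' t ∧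
            t ≤ C * (Nat.log 2 n + 1) ∧
            s'.Shows c r ∧ IsCenter c ∧ IsRadius (graph i j) d r := by
  -- Words up to `2 * n` suffice for the tree indices and the index sums. With `m = Nat.log 2 n + 1
  -- ≥ 1`, the query bound `84 * m + 240` is at most `324 * m`.
  refine ⟨preprocess, query, 2, 324, fun n hn X _ v hv d hd => ⟨?_, fun s hs i j => ?_⟩⟩
  · obtain ⟨s, t, he, ht, -⟩ := run_preprocess (d := d) hn le_rfl
    exact ⟨s, t, he, by omega⟩
  · have hdist := isDist_of_dist hv hd
    obtain ⟨s', t, he, ht, -, c, r, hc⟩ := run_query_shows hdist (hs.ready hn hdist le_rfl) le_rfl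
      (Nat.lt_pow_succ_log_self one_lt_two n) i j
    exact ⟨s', t, c, r, he, by simp only [Nat.succ_eq_add_one] at ht; omega, hc⟩
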